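/- Let $L>0$, $T>0$, $k\in\mathbb R$ and $\Omega=(0,L)\times(0,L)$. For $m\ge 1$ let $H_P^m(\Omega)$ be the space of real $f\in H^m(\Omega)$ such that, for every $|\alpha|\le m-1$, the trace of $D^\alpha f$ on $\partial\Omega$ takes the same values (almost everywhere) on opposite sides of $\Omega$. Put $$\mathcal U=\{u\in L^2(0,T;H_P^3(\Omega)) : u_t\in L^2(0,T;H_P^2(\Omega))\},\qquad \mathcal W=\{w\in L^2(0,T;H_P^1(\Omega)) : w_t\in L^2(0,T;L^2(\Omega))\},$$ where $u_t,w_t$ are weak time derivatives and elements of $\mathcal U$ and $\mathcal W$ are identified with their representatives that are continuous from $[0,T]$ to $L^2(\Omega)$. Let $u_0\in H_P^3(\Omega)$ be such that $w_0:=u_0-\Delta u_0\in L^\infty(\Omega)$. A solution on $[0,T]$ is a pair $(u,w)\in\mathcal U\times\mathcal W$ such that $$w_t-u_y\,w_x+u_x\,w_y=k\,u_y,\qquad -\Delta u+u=w\qquad\text{a.e. on }\Omega\times(0,T),$$ with $u(0)=u_0$ and $w(0)=w_0$. **Proposition.** Let $(u,w)$ be a solution on $[0,T]$ with $w\in C([0,T],L^\infty(\Omega))$.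 Then it is the unique solution: every solution $(u_1,w_1)\in\mathcal U\times\mathcal W$ on $[0,T]$ with the same $u_0$ satisfies $u_1(t)=u(t)$ and $w_1(t)=w(t)$ in $L^2(\Omega)$ for all $t\in[0,T]$. -/

import Mathlib

open MeasureTheory Filter Topology

namespace HasegawaMima

noncomputable section

/-- The open square `Ω = (0, L) × (0, L)`. -/
def square (L : ℝ) : Set (ℝ × ℝ) := Set.Ioo 0 L ×ˢ Set.Ioo 0 L

/-- The real Hilbert space `L²(Ω)`. -/
abbrev L2 (L : ℝ) : Type := Lp ℝ 2 ((volume : Measure (ℝ × ℝ)).restrict (square L))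

/-- The space `L²(0, L)` on a side of the square. -/
abbrev L2Side (L : ℝ) : Type := Lp ℝ 2 ((volume : Measure ℝ).restrict (Set.Ioo 0 L))

/-- The classical partial derivative `∂φ/∂x`. -/
def dx (φ : ℝ × ℝ → ℝ) : ℝ × ℝ → ℝ := fun p => fderiv ℝ φ p (1, 0)

/-- The classical partial derivative `∂φ/∂y`. -/
def dy (φ : ℝ × ℝ → ℝ) : ℝ × ℝ → ℝ := fun p => fderiv ℝ φ p (0, 1)

/-- The classical partial derivative `∂ₓᵃ ∂ᵧᵇ φ`. -/
def partialD (a b : ℕ) (φ : ℝ × ℝ → ℝ) : ℝ × ℝ → ℝ := dx^[a] (dy^[b] φ)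

/-- `g` is the weak derivative `∂ₓᵃ ∂ᵧᵇ f` on `Ω`. -/
def HasWeakDeriv (L : ℝ) (a b : ℕ) (f g : L2 L) : Prop :=
  ∀ φ : ℝ × ℝ → ℝ, ContDiff ℝ (⊤ : ℕ∞) φ → HasCompactSupport φ → tsupport φ ⊆ square L →
    ∫ p in square L, f p * partialD a b φ p = (-1) ^ (a + b) * ∫ p in square L, g p * φ p

/-- Bi-indices `(a, b)` of length `a + b ≤ m`. -/
abbrev BiIndex (m : ℕ) : Type :=
  {α : Fin (m + 1) × Fin (m + 1) // (α.1 : ℕ) + (α.2 : ℕ) ≤ m}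

/-- The bi-index `(a, b)`. -/
def bi {m : ℕ} (a b : ℕ) (h : a + b ≤ m) : BiIndex m :=
  ⟨(⟨a, by omega⟩, ⟨b, by omega⟩), h⟩

/-- Families `(J α)` of `L²(Ω)` functions indexed by `|α| ≤ m`, with the Hilbert norm
`‖J‖² = ∑_α ‖J α‖²`. A function `f ∈ H^m(Ω)` is represented by the family of its weak derivatives
`J α = D^α f`, so that this norm is the usual norm of `H^m(Ω)`. -/
abbrev Jet (L : ℝ) (m : ℕ) : Type := PiLp 2 (fun _ : BiIndex m => L2 L)

/-- The component `∂ₓᵃ ∂ᵧᵇ` of a family. -/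
def Jet.D {L : ℝ} {m : ℕ} (J : Jet L m) (a b : ℕ) (h : a + b ≤ m) : L2 L := J (bi a b h)

/-- The underlying function of a family. -/
def Jet.fn {L : ℝ} {m : ℕ} (J : Jet L m) : L2 L := J (bi 0 0 (by omega))

/-- The Sobolev space `H^m(Ω)`. -/
def sobolev (L : ℝ) (m : ℕ) : Set (Jet L m) :=
  {J | ∀ (a b : ℕ) (h : a + b ≤ m), HasWeakDeriv L a b J.fn (Jet.D J a b h)}

/-- The function `f ∈ H¹(Ω)`, with weak gradient `(fx, fy)`, has the trace on `∂Ω` that is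
`left`, `right` on the sides `x = 0`, `x = L` and `bottom`, `top` on the sides `y = 0`, `y = L`.
The trace operator is the continuous extension to `H¹(Ω)` of the restriction map
`φ ↦ φ|_∂Ω` from smooth functions on the closed square, with values in `L²(∂Ω)`. -/
def HasTrace {L : ℝ} (f fx fy : L2 L) (left right bottom top : L2Side L) : Prop :=
  ∃ φ : ℕ → ℝ × ℝ → ℝ,
    (∀ n, ContDiff ℝ (⊤ : ℕ∞) (φ n)) ∧
    Tendsto (fun n => eLpNorm (fun p => φ n p - f p) 2 (volume.restrict (square L)))
      atTop (𝓝 0) ∧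
    Tendsto (fun n => eLpNorm (fun p => dx (φ n) p - fx p) 2 (volume.restrict (square L)))
      atTop (𝓝 0) ∧
    Tendsto (fun n => eLpNorm (fun p => dy (φ n) p - fy p) 2 (volume.restrict (square L)))
      atTop (𝓝 0) ∧
    Tendsto (fun n => eLpNorm (fun y => φ n (0, y) - left y) 2 (volume.restrict (Set.Ioo 0 L)))
      atTop (𝓝 0) ∧
    Tendsto (fun n => eLpNorm (fun y => φ n (L, y) - right y) 2 (volume.restrict (Set.Ioo 0 L)))
      atTop (𝓝 0) ∧
    Tendsto (fun n => eLpNorm (fun x => φ n (x, 0) - bottom x) 2 (volume.restrict (Set.Ioo 0 L)))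
      atTop (𝓝 0) ∧
    Tendsto (fun n => eLpNorm (fun x => φ n (x, L) - top x) 2 (volume.restrict (Set.Ioo 0 L)))
      atTop (𝓝 0)

/-- The trace of `f ∈ H¹(Ω)`, with weak gradient `(fx, fy)`, is periodic: its values on opposite
sides agree almost everywhere. -/
def TracePeriodic {L : ℝ} (f fx fy : L2 L) : Prop :=
  ∃ left right bottom top : L2Side L,
    HasTrace f fx fy left right bottom top ∧ left = right ∧ bottom = top

/-- The periodic Sobolev space `H_P^m(Ω)`: those `f ∈ H^m(Ω)` such that `D^α f` has a periodic
trace for every `|α| ≤ m - 1`. -/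
def perSobolev (L : ℝ) (m : ℕ) : Set (Jet L m) :=
  {J | J ∈ sobolev L m ∧ ∀ (a b : ℕ) (h : a + b + 1 ≤ m),
    TracePeriodic (Jet.D J a b (by omega)) (Jet.D J (a + 1) b (by omega))
      (Jet.D J a (b + 1) (by omega))}

/-- The Bochner space `L²(0, T; H_P^m(Ω))`. -/
def MemL2Per {L : ℝ} {m : ℕ} (T : ℝ) (J : ℝ → Jet L m) : Prop :=
  MemLp J 2 (volume.restrict (Set.Ioo 0 T)) ∧
    ∀ᵐ t ∂(volume.restrict (Set.Ioo 0 T)), J t ∈ perSobolev L m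

/-- `v` is the weak time derivative of `u : (0, T) → L²(Ω)`. -/
def HasWeakTimeDeriv {L : ℝ} (T : ℝ) (u v : ℝ → L2 L) : Prop :=
  ∀ ψ : ℝ → ℝ, ContDiff ℝ (⊤ : ℕ∞) ψ → HasCompactSupport ψ → tsupport ψ ⊆ Set.Ioo 0 T →
    ∫ t in Set.Ioo 0 T, deriv ψ t • u t = - ∫ t in Set.Ioo 0 T, ψ t • v t

/-- `u` belongs to `𝒰 = {u ∈ L²(0, T; H_P³(Ω)) | u_t ∈ L²(0, T; H_P²(Ω))}`, where `U t` is the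
family of weak derivatives of `u t` and `U' t` that of `u_t t`. Such a function is identified with
its representative that is continuous on `[0, T]`, which gives a meaning to `u 0`. -/
structure MemU {L : ℝ} (T : ℝ) (u : ℝ → L2 L) (U : ℝ → Jet L 3) (U' : ℝ → Jet L 2) : Prop where
  continuousOn : ContinuousOn u (Set.Icc 0 T)
  mem : MemL2Per T U
  fn_eq : ∀ᵐ t ∂(volume.restrict (Set.Ioo 0 T)), (U t).fn = u t
  mem_deriv : MemL2Per T U'
  deriv : HasWeakTimeDeriv T u (fun t => (U' t).fn)

/-- `w` belongs to `𝒲 = {w ∈ L²(0, T; H_P¹(Ω)) | w_t ∈ L²(0, T; L²(Ω))}`, where `W t` is the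
family of weak derivatives of `w t` and `w' = w_t`. As above, `w` is the continuous
representative. -/
structure MemW {L : ℝ} (T : ℝ) (w : ℝ → L2 L) (W : ℝ → Jet L 1) (w' : ℝ → L2 L) : Prop where
  continuousOn : ContinuousOn w (Set.Icc 0 T)
  mem : MemL2Per T W
  fn_eq : ∀ᵐ t ∂(volume.restrict (Set.Ioo 0 T)), (W t).fn = w t
  mem_deriv : MemLp w' 2 (volume.restrict (Set.Ioo 0 T))
  deriv : HasWeakTimeDeriv T w w'

/-- `(I - Δ) f` for `f ∈ H³(Ω)`. -/
def helmholtz {L : ℝ} (J : Jet L 3) : L2 L :=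
  J.fn - (Jet.D J 2 0 (by omega) + Jet.D J 0 2 (by omega))

/-- `(u, w) ∈ 𝒰 × 𝒲` is a solution of the Hasegawa-Mima coupled system on `[0, T]`:
`w_t + V(u) · ∇w = k u_y` with `V(u) = (-u_y, u_x)`, and `-Δu + u = w`, almost everywhere, with
periodic boundary conditions (contained in `𝒰 × 𝒲`), `u(0) = u₀` and `w(0) = (I - Δ) u₀`. -/
def IsSolution {L : ℝ} (T k : ℝ) (u₀ : Jet L 3) (u w : ℝ → L2 L) : Prop :=
  ∃ (U : ℝ → Jet L 3) (U' : ℝ → Jet L 2) (W : ℝ → Jet L 1) (w' : ℝ → L2 L),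
    MemU T u U U' ∧ MemW T w W w' ∧
    (∀ᵐ t ∂(volume.restrict (Set.Ioo 0 T)), ∀ᵐ p ∂(volume.restrict (square L)),
      w' t p + (-(Jet.D (U t) 0 1 (by omega) p) * Jet.D (W t) 1 0 (by omega) p
          + Jet.D (U t) 1 0 (by omega) p * Jet.D (W t) 0 1 (by omega) p)
        = k * Jet.D (U t) 0 1 (by omega) p) ∧
    (∀ᵐ t ∂(volume.restrict (Set.Ioo 0 T)), helmholtz (U t) = w t) ∧
    u 0 = u₀.fn ∧ w 0 = helmholtz u₀

/-- `w ∈ C([0, T], L^∞(Ω))`. -/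
def ContinuousIntoLinfty {L : ℝ} (T : ℝ) (w : ℝ → L2 L) : Prop :=
  ∃ v : ℝ → Lp ℝ ⊤ ((volume : Measure (ℝ × ℝ)).restrict (square L)),
    ContinuousOn v (Set.Icc 0 T) ∧
    ∀ t ∈ Set.Icc 0 T, (v t : ℝ × ℝ → ℝ) =ᵐ[volume.restrict (square L)] (w t : ℝ × ℝ → ℝ)

end

end HasegawaMima

open MeasureTheory Filter Topology
open scoped ENNReal

namespace HasegawaMima

noncomputable section

/-! ### Sobolev inequalities for smooth functions on the square -/

/-! This is a Yudovich-type argument in the energy norm. For two solutions put η = u₁ - u and ξ = w₁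
- w = η - Δη. The energy E = ⟨η, ξ⟩ equals ‖η‖² + ‖∇η‖², and because I - Δ is symmetric under
periodic boundary conditions, E' = 2⟨η, ξ_t⟩. With {f, g} = f_x g_y - f_y g_x, subtracting the
equations gives ξ_t = k η_y - {u, ξ} - {η, w₁}. The first and last terms are orthogonal to η, and
integration by parts turns ⟨η, {u, ξ}⟩ into a quadratic form in ∇η whose coefficients are second
derivatives of u (`tri_bracket_eq`).

At almost every time D²u lies in H¹(Ω), which just fails to embed in L^∞, so Grönwall does not apply
directly. But H¹(Ω) embeds in L^{2q}(Ω) with a constant O(q) (`lintegral_pow_le_factorial`).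
Splitting |D²u| at a height proportional to nK then yields, for every n ≥ 1, |⟨η, ξ_t⟩| ≤ 12 n K (E
+ C 4⁻ⁿ ‖ξ‖²) (`lintegral_mul_sq_le`, `abs_form_le`), where K is affine in the H³ norm of u, hence
integrable in time. Since ‖ξ‖ is bounded on [0, T], Grönwall started where E = 0 gives E ≤ M 4⁻ⁿ
exp(2n ∫ κ) with κ a multiple of K. On an interval with ∫ κ ≤ 1/4 this tends to 0 as n → ∞, so E
stays zero there; such intervals may be taken of uniform length, so finitely many steps reach T
(`eq_zero_of_integral_le`).

Two technical points carry the rest. Traces match only in L², while trilinear terms are integrated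
by parts; this works because restrictions to the sides of an H¹-convergent sequence of smooth
functions are bounded in L⁴ (`H1Approx.exists_side_bound`). And the energy identity needs only
continuity of η in time, symmetry, and ξ being the primitive of its weak derivative
(`inner_sub_eq_integral`). -/

theorem volume_restrict_square (L : ℝ) :
    (volume : Measure (ℝ × ℝ)).restrict (square L) =
      ((volume : Measure ℝ).restrict (Set.Ioo 0 L)).prod
        ((volume : Measure ℝ).restrict (Set.Ioo 0 L)) := by
  rw [Measure.prod_restrict, square, Measure.volume_eq_prod]

theorem sq_lintegral_mul_le {α : Type*} [MeasurableSpace α] (μ : Measure α) {f g : α → ℝ≥0∞}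
    (hf : AEMeasurable f μ) (hg : AEMeasurable g μ) :
    (∫⁻ a, f a * g a ∂μ) ^ 2 ≤ (∫⁻ a, f a ^ 2 ∂μ) * ∫⁻ a, g a ^ 2 ∂μ := by
  have h := ENNReal.lintegral_mul_le_Lp_mul_Lq μ Real.HolderConjugate.two_two hf hg
  simp only [Pi.mul_apply, ENNReal.rpow_two] at h
  calc (∫⁻ a, f a * g a ∂μ) ^ 2
      ≤ ((∫⁻ a, f a ^ 2 ∂μ) ^ (1 / 2 : ℝ) * (∫⁻ a, g a ^ 2 ∂μ) ^ (1 / 2 : ℝ)) ^ 2 := by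
        gcongr
    _ = _ := by
        rw [mul_pow, ← ENNReal.rpow_natCast, ← ENNReal.rpow_mul, ← ENNReal.rpow_natCast,
          ← ENNReal.rpow_mul]
        norm_num

/-- A smooth function on an interval is bounded by its `W^{1,1}` norm. -/
theorem enorm_le_lintegral_add_deriv {L : ℝ} (hL : 0 < L) {h : ℝ → ℝ} (hh : ContDiff ℝ 1 h)
    {x : ℝ} (hx : x ∈ Set.Icc 0 L) :
    ‖h x‖ₑ ≤ ∫⁻ s in Set.Ioo 0 L, (ENNReal.ofReal (1 / L) * ‖h s‖ₑ + ‖deriv h s‖ₑ) := by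
  have hd : Continuous (deriv h) := hh.continuous_deriv le_rfl
  set I := ∫⁻ s in Set.Ioo 0 L, ‖deriv h s‖ₑ with hI
  have hIcc : I = ∫⁻ s in Set.Icc 0 L, ‖deriv h s‖ₑ := setLIntegral_congr Ioo_ae_eq_Icc
  have key : ∀ a b, a ∈ Set.Icc 0 L → b ∈ Set.Icc 0 L → a ≤ b → ‖h b - h a‖ₑ ≤ I := by
    intro a b ha hb hab
    refine (enorm_sub_le_lintegral_deriv_of_contDiffOn_Icc hh.contDiffOn hab).trans ?_
    rw [hIcc]
    exact lintegral_mono_set (Set.Icc_subset_Icc ha.1 hb.2)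
  have hpt : ∀ s ∈ Set.Ioo 0 L, ‖h x‖ₑ ≤ ‖h s‖ₑ + I := by
    intro s hs
    have hs' : s ∈ Set.Icc 0 L := Set.Ioo_subset_Icc_self hs
    have h1 : ‖h x - h s‖ₑ ≤ I := by
      rcases le_total s x with hsx | hsx
      · exact key s x hs' hx hsx
      · rw [← enorm_neg, neg_sub]; exact key x s hx hs' hsx
    calc ‖h x‖ₑ = ‖h s + (h x - h s)‖ₑ := by congr 1; ring
      _ ≤ ‖h s‖ₑ + ‖h x - h s‖ₑ := enorm_add_le _ _
      _ ≤ _ := by gcongr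
  have hvol : (volume : Measure ℝ) (Set.Ioo 0 L) = ENNReal.ofReal L := by simp
  have hcL : ENNReal.ofReal (1 / L) * ENNReal.ofReal L = 1 := by
    rw [← ENNReal.ofReal_mul (by positivity)]; simp [hL.ne']
  -- Average the pointwise bound `hpt` over s.
  calc ‖h x‖ₑ = ENNReal.ofReal (1 / L) * ∫⁻ s in Set.Ioo 0 L, ‖h x‖ₑ := by
        rw [setLIntegral_const, hvol, mul_comm ‖h x‖ₑ, ← mul_assoc, hcL, one_mul]
    _ ≤ ENNReal.ofReal (1 / L) * ∫⁻ s in Set.Ioo 0 L, (‖h s‖ₑ + I) := by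
        gcongr 1
        exact setLIntegral_mono' measurableSet_Ioo hpt
    _ = ENNReal.ofReal (1 / L) * (∫⁻ s in Set.Ioo 0 L, ‖h s‖ₑ) + I := by
        rw [lintegral_add_right _ measurable_const, setLIntegral_const, hvol, mul_add,
          mul_comm I, ← mul_assoc, hcL, one_mul]
    _ = _ := by
        rw [lintegral_add_right _ hd.enorm.measurable, lintegral_const_mul _ hh.continuous.enorm.measurable]

/-! ### Slices of smooth functions and the Gagliardo–Nirenberg recursion -/

section smooth

variable {φ : ℝ × ℝ → ℝ}

theorem hasDerivAt_slice_fst (hφ : ContDiff ℝ (⊤ : ℕ∞) φ) (x y : ℝ) :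
    HasDerivAt (fun s => φ (s, y)) (dx φ (x, y)) x := by
  have h1 : HasFDerivAt φ (fderiv ℝ φ (x, y)) (x, y) :=
    (hφ.differentiable (by simp)).differentiableAt.hasFDerivAt
  have h2 : HasDerivAt (fun s : ℝ => (s, y)) ((1 : ℝ), (0 : ℝ)) x :=
    (hasDerivAt_id x).prodMk (hasDerivAt_const x y)
  exact h1.comp_hasDerivAt x h2

theorem hasDerivAt_slice_snd (hφ : ContDiff ℝ (⊤ : ℕ∞) φ) (x y : ℝ) :
    HasDerivAt (fun s => φ (x, s)) (dy φ (x, y)) y := by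
  have h1 : HasFDerivAt φ (fderiv ℝ φ (x, y)) (x, y) :=
    (hφ.differentiable (by simp)).differentiableAt.hasFDerivAt
  have h2 : HasDerivAt (fun s : ℝ => (x, s)) ((0 : ℝ), (1 : ℝ)) y :=
    (hasDerivAt_const y x).prodMk (hasDerivAt_id y)
  exact h1.comp_hasDerivAt y h2

theorem continuous_dx (hφ : ContDiff ℝ (⊤ : ℕ∞) φ) : Continuous (dx φ) :=
  (hφ.continuous_fderiv (by simp)).clm_apply continuous_const

theorem continuous_dy (hφ : ContDiff ℝ (⊤ : ℕ∞) φ) : Continuous (dy φ) :=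
  (hφ.continuous_fderiv (by simp)).clm_apply continuous_const

/-- The density `|φ|^m (c |φ| + (m + 1) |ψ|)`, which for `ψ = ∂φ` bounds the `W^{1,1}` density
of `φ^(m+1)`. -/
def powDensity (c : ℝ≥0∞) (m : ℕ) (φ ψ : ℝ × ℝ → ℝ) (p : ℝ × ℝ) : ℝ≥0∞ :=
  ‖φ p‖ₑ ^ m * (c * ‖φ p‖ₑ + (m + 1) * ‖ψ p‖ₑ)

theorem measurable_powDensity {c : ℝ≥0∞} {m : ℕ} {ψ : ℝ × ℝ → ℝ} (hφ : Continuous φ)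
    (hψ : Continuous ψ) : Measurable (powDensity c m φ ψ) := by
  have := hφ.enorm.measurable
  have := hψ.enorm.measurable
  unfold powDensity
  fun_prop

theorem enorm_pow_le_slice_fst {L : ℝ} (hL : 0 < L) (hφ : ContDiff ℝ (⊤ : ℕ∞) φ) (m : ℕ)
    {x : ℝ} (hx : x ∈ Set.Icc 0 L) (y : ℝ) :
    ‖φ (x, y)‖ₑ ^ (m + 1) ≤
      ∫⁻ s in Set.Ioo 0 L, powDensity (ENNReal.ofReal (1 / L)) m φ (dx φ) (s, y) := by
  have hs : ContDiff ℝ 1 (fun s => φ (s, y) ^ (m + 1)) :=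
    (((hφ.of_le (m := 1) (by exact_mod_cast le_top)).comp (contDiff_id.prodMk contDiff_const)).pow _ :)
  have h := enorm_le_lintegral_add_deriv hL hs hx
  simp only [enorm_pow] at h
  refine h.trans (le_of_eq ?_)
  congr 1
  ext s
  rw [((hasDerivAt_slice_fst hφ s y).fun_pow (m + 1)).deriv, powDensity, enorm_mul, enorm_mul]
  simp only [enorm_pow, Nat.cast_add, Nat.cast_one, add_tsub_cancel_right]
  have : ‖(m : ℝ) + 1‖ₑ = (m : ℝ≥0∞) + 1 := by
    rw [Real.enorm_eq_ofReal (by positivity), ENNReal.ofReal_add (by positivity) (by norm_num)]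
    simp
  rw [this]; ring

theorem enorm_pow_le_slice_snd {L : ℝ} (hL : 0 < L) (hφ : ContDiff ℝ (⊤ : ℕ∞) φ) (m : ℕ)
    (x : ℝ) {y : ℝ} (hy : y ∈ Set.Icc 0 L) :
    ‖φ (x, y)‖ₑ ^ (m + 1) ≤
      ∫⁻ s in Set.Ioo 0 L, powDensity (ENNReal.ofReal (1 / L)) m φ (dy φ) (x, s) := by
  have hs : ContDiff ℝ 1 (fun s => φ (x, s) ^ (m + 1)) :=
    (((hφ.of_le (m := 1) (by exact_mod_cast le_top)).comp (contDiff_const.prodMk contDiff_id)).pow _ :)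
  have h := enorm_le_lintegral_add_deriv hL hs hy
  simp only [enorm_pow] at h
  refine h.trans (le_of_eq ?_)
  congr 1
  ext s
  rw [((hasDerivAt_slice_snd hφ x s).fun_pow (m + 1)).deriv, powDensity, enorm_mul, enorm_mul]
  simp only [enorm_pow, Nat.cast_add, Nat.cast_one, add_tsub_cancel_right]
  have : ‖(m : ℝ) + 1‖ₑ = (m : ℝ≥0∞) + 1 := by
    rw [Real.enorm_eq_ofReal (by positivity), ENNReal.ofReal_add (by positivity) (by norm_num)]
    simp
  rw [this]; ring

/-- Gagliardo–Nirenberg: one factor |φ|^(m+1) is bounded by a function of x alone, the other by a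
function of y alone, so the integral of the product factorizes. -/
theorem lintegral_pow_le_mul {L : ℝ} (hL : 0 < L) (hφ : ContDiff ℝ (⊤ : ℕ∞) φ) (m : ℕ) :
    ∫⁻ p in square L, ‖φ p‖ₑ ^ (2 * (m + 1)) ≤
      (∫⁻ p in square L, powDensity (ENNReal.ofReal (1 / L)) m φ (dy φ) p) *
        ∫⁻ p in square L, powDensity (ENNReal.ofReal (1 / L)) m φ (dx φ) p := by
  set c := ENNReal.ofReal (1 / L)
  have hX : Measurable (powDensity c m φ (dx φ)) :=
    measurable_powDensity hφ.continuous (continuous_dx hφ)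
  have hY : Measurable (powDensity c m φ (dy φ)) :=
    measurable_powDensity hφ.continuous (continuous_dy hφ)
  have hm : MeasurableSet (square L) := measurableSet_Ioo.prod measurableSet_Ioo
  calc ∫⁻ p in square L, ‖φ p‖ₑ ^ (2 * (m + 1))
      ≤ ∫⁻ p in square L, (∫⁻ s in Set.Ioo 0 L, powDensity c m φ (dy φ) (p.1, s)) *
          (∫⁻ s in Set.Ioo 0 L, powDensity c m φ (dx φ) (s, p.2)) := by
        refine setLIntegral_mono' hm fun p hp => ?_
        rw [two_mul, pow_add]
        exact mul_le_mul'
          (enorm_pow_le_slice_snd hL hφ m p.1 (Set.Ioo_subset_Icc_self hp.2))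
          (enorm_pow_le_slice_fst hL hφ m (Set.Ioo_subset_Icc_self hp.1) p.2)
    _ = _ := by
        rw [volume_restrict_square, lintegral_prod_mul
          (f := fun x => ∫⁻ s in Set.Ioo 0 L, powDensity c m φ (dy φ) (x, s))
          (g := fun y => ∫⁻ s in Set.Ioo 0 L, powDensity c m φ (dx φ) (s, y))
          hY.lintegral_prod_right'.aemeasurable hX.lintegral_prod_left'.aemeasurable,
          lintegral_prod _ hY.aemeasurable, lintegral_prod_symm _ hX.aemeasurable]

/-- The square of the `H¹(Ω)` norm, for the gradient `(fx, fy)`. -/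
def h1Sq (L : ℝ) (f fx fy : ℝ × ℝ → ℝ) : ℝ≥0∞ :=
  (∫⁻ p in square L, ‖f p‖ₑ ^ 2) + (∫⁻ p in square L, ‖fx p‖ₑ ^ 2) +
    ∫⁻ p in square L, ‖fy p‖ₑ ^ 2

/-- The constant in the Sobolev inequalities on the square of side `L`. -/
def sobConst (L : ℝ) : ℝ≥0∞ := 2 * (ENNReal.ofReal (1 / L) ^ 2 + 1)

/-- Cauchy–Schwarz separates |φ|^m from the first-order factor. The coefficient (m + 1)² is kept
explicit because the growth of the embedding constants decides the final argument. -/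
theorem sq_lintegral_powDensity_le {L : ℝ} (m : ℕ) {ψ : ℝ × ℝ → ℝ}
    (hφ : Continuous φ) (hψ : Continuous ψ) :
    (∫⁻ p in square L, powDensity (ENNReal.ofReal (1 / L)) m φ ψ p) ^ 2 ≤
      (∫⁻ p in square L, ‖φ p‖ₑ ^ (2 * m)) * ((m + 1) ^ 2 * sobConst L *
        ((∫⁻ p in square L, ‖φ p‖ₑ ^ 2) + ∫⁻ p in square L, ‖ψ p‖ₑ ^ 2)) := by
  set c := ENNReal.ofReal (1 / L) with hc
  have h1 := hφ.enorm.measurable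
  have h2 := hψ.enorm.measurable
  have h := sq_lintegral_mul_le (volume.restrict (square L))
    (f := fun p => ‖φ p‖ₑ ^ m) (g := fun p => c * ‖φ p‖ₑ + (m + 1) * ‖ψ p‖ₑ)
    (by fun_prop) (by fun_prop)
  refine h.trans ?_
  simp only [← pow_mul, mul_comm m 2]
  gcongr
  rw [← lintegral_add_left (by fun_prop), ← lintegral_const_mul _ (by fun_prop)]
  refine lintegral_mono fun p => ?_
  set a := ‖φ p‖ₑ with ha
  set b := ‖ψ p‖ₑ
  have hsq : ∀ x y : ℝ≥0∞, (x + y) ^ 2 ≤ 2 * (x ^ 2 + y ^ 2) := by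
    intro x y
    have h := ENNReal.rpow_add_le_mul_rpow_add_rpow x y (p := 2) (by norm_num)
    norm_num at h
    exact h
  have hm1 : (1 : ℝ≥0∞) ≤ (m + 1) ^ 2 := one_le_pow₀ (by simp)
  calc (c * a + (m + 1) * b) ^ 2 ≤ 2 * ((c * a) ^ 2 + ((m + 1) * b) ^ 2) := hsq _ _
    _ = 2 * (1 * (c ^ 2 * a ^ 2) + (m + 1) ^ 2 * b ^ 2) := by ring
    _ ≤ 2 * ((m + 1) ^ 2 * ((c ^ 2 + 1) * a ^ 2) + (m + 1) ^ 2 * ((c ^ 2 + 1) * b ^ 2)) := by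
        gcongr
        · exact le_self_add
        · exact le_mul_of_one_le_left (by simp) (by simp)
    _ = _ := by rw [sobConst]; ring

/-- Raising the exponent by 2 costs one factor (m + 1)² times the squared H¹ norm; iterating
produces (q!)². The bound is proved after squaring, where the two directional estimates multiply. -/
theorem lintegral_pow_succ_le {L : ℝ} (hL : 0 < L) (hφ : ContDiff ℝ (⊤ : ℕ∞) φ) (m : ℕ) :
    ∫⁻ p in square L, ‖φ p‖ₑ ^ (2 * (m + 1)) ≤
      (∫⁻ p in square L, ‖φ p‖ₑ ^ (2 * m)) *
        ((m + 1) ^ 2 * sobConst L * h1Sq L φ (dx φ) (dy φ)) := by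
  refine (ENNReal.pow_le_pow_left_iff two_ne_zero).mp ?_
  have hx := sq_lintegral_powDensity_le (L := L) m hφ.continuous (continuous_dx hφ)
  have hy := sq_lintegral_powDensity_le (L := L) m hφ.continuous (continuous_dy hφ)
  calc (∫⁻ p in square L, ‖φ p‖ₑ ^ (2 * (m + 1))) ^ 2
      ≤ (_ * _) ^ 2 := by gcongr; exact lintegral_pow_le_mul hL hφ m
    _ = _ ^ 2 * _ ^ 2 := mul_pow _ _ _
    _ ≤ _ * _ := mul_le_mul' hy hx
    _ ≤ ((∫⁻ p in square L, ‖φ p‖ₑ ^ (2 * m)) *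
        ((m + 1) ^ 2 * sobConst L * h1Sq L φ (dx φ) (dy φ))) *
        ((∫⁻ p in square L, ‖φ p‖ₑ ^ (2 * m)) *
        ((m + 1) ^ 2 * sobConst L * h1Sq L φ (dx φ) (dy φ))) := by
        gcongr
        · rw [h1Sq]; gcongr; exact le_self_add
        · rw [h1Sq]; exact le_self_add
    _ = _ := by ring

/-- The Sobolev inequality `H¹(Ω) ⊆ L^{2q}(Ω)`, with a constant of size `O(q)`. -/
theorem lintegral_pow_le_factorial {L : ℝ} (hL : 0 < L) (hφ : ContDiff ℝ (⊤ : ℕ∞) φ) (q : ℕ) :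
    ∫⁻ p in square L, ‖φ p‖ₑ ^ (2 * q) ≤
      volume (square L) * (q.factorial ^ 2 * (sobConst L * h1Sq L φ (dx φ) (dy φ)) ^ q) := by
  induction q with
  | zero => simp
  | succ m ih =>
    refine (lintegral_pow_succ_le hL hφ m).trans ?_
    calc _ ≤ (volume (square L) *
          (m.factorial ^ 2 * (sobConst L * h1Sq L φ (dx φ) (dy φ)) ^ m)) *
          ((m + 1) ^ 2 * sobConst L * h1Sq L φ (dx φ) (dy φ)) := by gcongr
      _ = _ := by rw [Nat.factorial_succ]; push_cast; ring

/-- The restriction of a smooth function to a side is bounded in `L⁴`. -/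
theorem sq_lintegral_side_fst_le {L : ℝ} (hL : 0 < L) (hφ : ContDiff ℝ (⊤ : ℕ∞) φ) {x : ℝ}
    (hx : x ∈ Set.Icc 0 L) :
    (∫⁻ y in Set.Ioo 0 L, ‖φ (x, y)‖ₑ ^ 4) ^ 2 ≤
      volume (square L) * (Nat.factorial 3 ^ 2 * (sobConst L * h1Sq L φ (dx φ) (dy φ)) ^ 3) *
        (4 ^ 2 * sobConst L * h1Sq L φ (dx φ) (dy φ)) := by
  have hX : Measurable (powDensity (ENNReal.ofReal (1 / L)) 3 φ (dx φ)) :=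
    measurable_powDensity hφ.continuous (continuous_dx hφ)
  -- The slice bound with m = 3 controls the fourth power on a side by an integral over the square,
  -- which the L⁶ and H¹ norms control.
  have h1 : ∫⁻ y in Set.Ioo 0 L, ‖φ (x, y)‖ₑ ^ 4 ≤
      ∫⁻ p in square L, powDensity (ENNReal.ofReal (1 / L)) 3 φ (dx φ) p := by
    rw [volume_restrict_square, lintegral_prod_symm _ hX.aemeasurable]
    exact lintegral_mono fun y => enorm_pow_le_slice_fst hL hφ 3 hx y
  calc _ ≤ _ ^ 2 := by gcongr
    _ ≤ _ := sq_lintegral_powDensity_le 3 hφ.continuous (continuous_dx hφ)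
    _ ≤ _ := by
      gcongr
      · exact lintegral_pow_le_factorial hL hφ 3
      · norm_num
      · rw [h1Sq]; exact le_self_add

theorem sq_lintegral_side_snd_le {L : ℝ} (hL : 0 < L) (hφ : ContDiff ℝ (⊤ : ℕ∞) φ) {y : ℝ}
    (hy : y ∈ Set.Icc 0 L) :
    (∫⁻ x in Set.Ioo 0 L, ‖φ (x, y)‖ₑ ^ 4) ^ 2 ≤
      volume (square L) * (Nat.factorial 3 ^ 2 * (sobConst L * h1Sq L φ (dx φ) (dy φ)) ^ 3) *
        (4 ^ 2 * sobConst L * h1Sq L φ (dx φ) (dy φ)) := by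
  have hY : Measurable (powDensity (ENNReal.ofReal (1 / L)) 3 φ (dy φ)) :=
    measurable_powDensity hφ.continuous (continuous_dy hφ)
  have h1 : ∫⁻ x in Set.Ioo 0 L, ‖φ (x, y)‖ₑ ^ 4 ≤
      ∫⁻ p in square L, powDensity (ENNReal.ofReal (1 / L)) 3 φ (dy φ) p := by
    rw [volume_restrict_square, lintegral_prod _ hY.aemeasurable]
    exact lintegral_mono fun x => enorm_pow_le_slice_snd hL hφ 3 x hy
  calc _ ≤ _ ^ 2 := by gcongr
    _ ≤ _ := sq_lintegral_powDensity_le 3 hφ.continuous (continuous_dy hφ)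
    _ ≤ _ := by
      gcongr
      · exact lintegral_pow_le_factorial hL hφ 3
      · norm_num
      · rw [h1Sq]; gcongr; exact le_self_add

end smooth

/-! ### Convergence in `Lᵖ` -/

section Lp

variable {α : Type*} [MeasurableSpace α] {μ : Measure α}

theorem eLpNorm_natCast_pow {q : ℕ} (hq : q ≠ 0) (f : α → ℝ) :
    eLpNorm f q μ ^ q = ∫⁻ a, ‖f a‖ₑ ^ q ∂μ := by
  have h := eLpNorm_nnreal_pow_eq_lintegral (μ := μ) (f := f) (p := (q : NNReal))
    (by exact_mod_cast hq)
  simpa [ENNReal.rpow_natCast] using h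

theorem tendsto_eLpNorm_of_sub {p : ℝ≥0∞} (hp : 1 ≤ p) {φ : ℕ → α → ℝ} {f : α → ℝ}
    (hφ : ∀ n, AEStronglyMeasurable (φ n) μ) (hf : MemLp f p μ)
    (h : Tendsto (fun n => eLpNorm (fun a => φ n a - f a) p μ) atTop (𝓝 0)) :
    Tendsto (fun n => eLpNorm (φ n) p μ) atTop (𝓝 (eLpNorm f p μ)) := by
  have h1 : Tendsto (fun n => eLpNorm f p μ - eLpNorm (fun a => φ n a - f a) p μ) atTop
      (𝓝 (eLpNorm f p μ)) := by
    simpa using ENNReal.Tendsto.sub tendsto_const_nhds h (Or.inl hf.2.ne)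
  have h2 : Tendsto (fun n => eLpNorm f p μ + eLpNorm (fun a => φ n a - f a) p μ) atTop
      (𝓝 (eLpNorm f p μ)) := by
    simpa using (tendsto_const_nhds (x := eLpNorm f p μ)).add h
  refine tendsto_of_tendsto_of_tendsto_of_le_of_le h1 h2 (fun n => ?_) (fun n => ?_)
  · rw [tsub_le_iff_right]
    have := eLpNorm_sub_le (hφ n) ((hφ n).sub hf.1) hp
    simp only [sub_sub_cancel] at this
    exact this
  · have := eLpNorm_add_le hf.1 ((hφ n).sub hf.1) hp
    simp only [add_sub_cancel] at this
    exact this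

theorem eLpNorm_mul_le {p q r : ℝ≥0∞} [p.HolderTriple q r] {f g : α → ℝ}
    (hf : AEStronglyMeasurable f μ) (hg : AEStronglyMeasurable g μ) :
    eLpNorm (fun a => f a * g a) r μ ≤ eLpNorm f p μ * eLpNorm g q μ := by
  have h := eLpNorm_smul_le_mul_eLpNorm (p := p) (q := q) (r := r) hg hf
  have e : (fun a => f a * g a) = f • g := by ext a; simp
  rw [e]; exact h

/-- Expanding φψ - fg as (φ - f)(ψ - g) + (φ - f)g + f(ψ - g) requires finite norms of the limits
only. -/
theorem tendsto_eLpNorm_mul_sub {p q r : ℝ≥0∞} [p.HolderTriple q r] (hr : 1 ≤ r)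
    {φ ψ : ℕ → α → ℝ} {f g : α → ℝ}
    (hφ : ∀ n, AEStronglyMeasurable (φ n) μ) (hψ : ∀ n, AEStronglyMeasurable (ψ n) μ)
    (hf : MemLp f p μ) (hg : MemLp g q μ)
    (h1 : Tendsto (fun n => eLpNorm (fun a => φ n a - f a) p μ) atTop (𝓝 0))
    (h2 : Tendsto (fun n => eLpNorm (fun a => ψ n a - g a) q μ) atTop (𝓝 0)) :
    Tendsto (fun n => eLpNorm (fun a => φ n a * ψ n a - f a * g a) r μ) atTop (𝓝 0) := by
  have hlim : Tendsto (fun n => eLpNorm (fun a => φ n a - f a) p μ *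
      eLpNorm (fun a => ψ n a - g a) q μ + eLpNorm (fun a => φ n a - f a) p μ * eLpNorm g q μ +
      eLpNorm f p μ * eLpNorm (fun a => ψ n a - g a) q μ) atTop (𝓝 0) := by
    have e1 := ENNReal.Tendsto.mul h1 (Or.inr ENNReal.zero_ne_top) h2 (Or.inr ENNReal.zero_ne_top)
    have e2 := ENNReal.Tendsto.mul_const (b := eLpNorm g q μ) h1 (Or.inr hg.2.ne)
    have e3 := ENNReal.Tendsto.const_mul (a := eLpNorm f p μ) h2 (Or.inr hf.2.ne)
    simpa using (e1.add e2).add e3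
  refine tendsto_of_tendsto_of_tendsto_of_le_of_le tendsto_const_nhds hlim
    (fun n => zero_le) (fun n => ?_)
  have m1 := (hφ n).sub hf.1
  have m2 := (hψ n).sub hg.1
  have hdec : (fun a => φ n a * ψ n a - f a * g a) =
      (fun a => (φ n a - f a) * (ψ n a - g a)) + (fun a => (φ n a - f a) * g a) +
        (fun a => f a * (ψ n a - g a)) := by
    ext a; simp only [Pi.add_apply]; ring
  rw [hdec]
  refine (eLpNorm_add_le ((m1.mul m2).add (m1.mul hg.1)) (hf.1.mul m2) hr).trans ?_
  refine add_le_add ((eLpNorm_add_le (m1.mul m2) (m1.mul hg.1) hr).trans ?_) ?_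
  · exact add_le_add (eLpNorm_mul_le m1 m2) (eLpNorm_mul_le m1 hg.1)
  · exact eLpNorm_mul_le hf.1 m2

instance holderTriple_four_four_two : ENNReal.HolderTriple 4 4 2 where
  inv_add_inv_eq_inv := by
    rw [← two_mul, show (4 : ℝ≥0∞) = 2 * 2 by norm_num,
      ENNReal.mul_inv (Or.inl (by norm_num)) (Or.inl (by norm_num)), ← mul_assoc,
      ENNReal.mul_inv_cancel (by norm_num) (by norm_num), one_mul]

theorem eLpNorm_mul_mul_le {a b c : α → ℝ} (ha : AEStronglyMeasurable a μ)
    (hb : AEStronglyMeasurable b μ) (hc : AEStronglyMeasurable c μ) :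
    eLpNorm (fun x => a x * (b x * c x)) 1 μ ≤
      eLpNorm a 2 μ * (eLpNorm b 4 μ * eLpNorm c 4 μ) :=
  (eLpNorm_mul_le (p := 2) (q := 2) ha (hb.mul hc)).trans (by gcongr; exact eLpNorm_mul_le hb hc)

theorem integrable_mul_mul {a b c : α → ℝ} (ha : MemLp a 2 μ) (hb : MemLp b 4 μ)
    (hc : MemLp c 4 μ) : Integrable (fun x => a x * (b x * c x)) μ := by
  rw [← memLp_one_iff_integrable]
  exact (hc.mul hb (r := 2)).mul ha

/-- Hölder with 1/2 + 1/4 + 1/4 = 1: in the product rule the differentiated factor converges in L²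
and the other two in L⁴. -/
theorem tendsto_integral_mul_mul {a b c : ℕ → α → ℝ} {f g h : α → ℝ}
    (ha : ∀ n, MemLp (a n) 2 μ) (hb : ∀ n, MemLp (b n) 4 μ) (hc : ∀ n, MemLp (c n) 4 μ)
    (hf : MemLp f 2 μ) (hg : MemLp g 4 μ) (hh : MemLp h 4 μ)
    (ta : Tendsto (fun n => eLpNorm (fun x => a n x - f x) 2 μ) atTop (𝓝 0))
    (tb : Tendsto (fun n => eLpNorm (fun x => b n x - g x) 4 μ) atTop (𝓝 0))
    (tc : Tendsto (fun n => eLpNorm (fun x => c n x - h x) 4 μ) atTop (𝓝 0)) :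
    Tendsto (fun n => ∫ x, a n x * (b n x * c n x) ∂μ) atTop
      (𝓝 (∫ x, f x * (g x * h x) ∂μ)) := by
  refine tendsto_integral_of_L1' _ (integrable_mul_mul hf hg hh).1
    (Eventually.of_forall fun n => integrable_mul_mul (ha n) (hb n) (hc n)) ?_
  have t1 := tendsto_eLpNorm_mul_sub (r := 2) (by norm_num) (fun n => (hb n).1)
    (fun n => (hc n).1) hg hh tb tc
  exact tendsto_eLpNorm_mul_sub (r := 1) le_rfl (fun n => (ha n).1)
    (fun n => (hb n).1.mul (hc n).1) hf (hh.mul hg) ta t1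

end Lp

/-! ### Functions of `H¹(Ω)` approximated by smooth functions -/

instance isFiniteMeasure_restrict_square (L : ℝ) :
    IsFiniteMeasure ((volume : Measure (ℝ × ℝ)).restrict (square L)) := by
  rw [volume_restrict_square]; infer_instance

theorem memLp_square_of_continuous {g : ℝ × ℝ → ℝ} (hg : Continuous g) (L : ℝ) (p : ℝ≥0∞) :
    MemLp g p (volume.restrict (square L)) := by
  obtain ⟨C, hC⟩ := ((isCompact_Icc (a := (0 : ℝ)) (b := L)).prod
    (isCompact_Icc (a := (0 : ℝ)) (b := L))).exists_bound_of_continuousOn hg.continuousOn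
  refine MemLp.of_bound hg.aestronglyMeasurable C ?_
  refine (ae_restrict_mem (measurableSet_Ioo.prod measurableSet_Ioo)).mono fun x hx => hC x ?_
  exact ⟨Set.Ioo_subset_Icc_self hx.1, Set.Ioo_subset_Icc_self hx.2⟩

theorem memLp_Ioo_of_continuous {g : ℝ → ℝ} (hg : Continuous g) (L : ℝ) (p : ℝ≥0∞) :
    MemLp g p (volume.restrict (Set.Ioo 0 L)) := by
  obtain ⟨C, hC⟩ := (isCompact_Icc (a := (0 : ℝ)) (b := L)).exists_bound_of_continuousOn
    hg.continuousOn
  refine MemLp.of_bound hg.aestronglyMeasurable C ?_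
  exact (ae_restrict_mem measurableSet_Ioo).mono fun x hx => hC x (Set.Ioo_subset_Icc_self hx)

/-- The smooth functions `φ n` converge to `f` in `H¹(Ω)`, where `(fx, fy)` is the gradient. -/
structure H1Approx (L : ℝ) (f fx fy : ℝ × ℝ → ℝ) (φ : ℕ → ℝ × ℝ → ℝ) : Prop where
  smooth : ∀ n, ContDiff ℝ (⊤ : ℕ∞) (φ n)
  memLp : MemLp f 2 (volume.restrict (square L))
  memLp_x : MemLp fx 2 (volume.restrict (square L))
  memLp_y : MemLp fy 2 (volume.restrict (square L))
  tendsto : Tendsto (fun n => eLpNorm (fun p => φ n p - f p) 2 (volume.restrict (square L)))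
      atTop (𝓝 0)
  tendsto_x : Tendsto (fun n => eLpNorm (fun p => dx (φ n) p - fx p) 2
      (volume.restrict (square L))) atTop (𝓝 0)
  tendsto_y : Tendsto (fun n => eLpNorm (fun p => dy (φ n) p - fy p) 2
      (volume.restrict (square L))) atTop (𝓝 0)

theorem h1Sq_eq (L : ℝ) (f fx fy : ℝ × ℝ → ℝ) :
    h1Sq L f fx fy = eLpNorm f 2 (volume.restrict (square L)) ^ 2 +
      eLpNorm fx 2 (volume.restrict (square L)) ^ 2 +
      eLpNorm fy 2 (volume.restrict (square L)) ^ 2 := by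
  have h := fun g : ℝ × ℝ → ℝ => eLpNorm_natCast_pow (μ := volume.restrict (square L))
    two_ne_zero g
  simp only [Nat.cast_ofNat] at h
  rw [h, h, h, h1Sq]

theorem dx_sub {φ ψ : ℝ × ℝ → ℝ} (hφ : ContDiff ℝ (⊤ : ℕ∞) φ) (hψ : ContDiff ℝ (⊤ : ℕ∞) ψ)
    (p : ℝ × ℝ) : dx (fun p => φ p - ψ p) p = dx φ p - dx ψ p := by
  simp only [dx]
  rw [fderiv_fun_sub (hφ.differentiable (by simp)).differentiableAt
    (hψ.differentiable (by simp)).differentiableAt]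
  simp

theorem dy_sub {φ ψ : ℝ × ℝ → ℝ} (hφ : ContDiff ℝ (⊤ : ℕ∞) φ) (hψ : ContDiff ℝ (⊤ : ℕ∞) ψ)
    (p : ℝ × ℝ) : dy (fun p => φ p - ψ p) p = dy φ p - dy ψ p := by
  simp only [dy]
  rw [fderiv_fun_sub (hφ.differentiable (by simp)).differentiableAt
    (hψ.differentiable (by simp)).differentiableAt]
  simp

theorem tendsto_eLpNorm_sub_sub {α : Type*} [MeasurableSpace α] {μ : Measure α} {p : ℝ≥0∞}
    (hp : 1 ≤ p) {φ ψ : ℕ → α → ℝ} {f g : α → ℝ}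
    (hφ : ∀ n, AEStronglyMeasurable (φ n) μ) (hψ : ∀ n, AEStronglyMeasurable (ψ n) μ)
    (hf : AEStronglyMeasurable f μ) (hg : AEStronglyMeasurable g μ)
    (h1 : Tendsto (fun n => eLpNorm (fun a => φ n a - f a) p μ) atTop (𝓝 0))
    (h2 : Tendsto (fun n => eLpNorm (fun a => ψ n a - g a) p μ) atTop (𝓝 0)) :
    Tendsto (fun n => eLpNorm (fun a => (φ n a - ψ n a) - (f a - g a)) p μ) atTop (𝓝 0) := by
  have h := h1.add h2
  rw [add_zero] at h
  refine tendsto_of_tendsto_of_tendsto_of_le_of_le tendsto_const_nhds h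
    (fun n => zero_le) (fun n => ?_)
  have := eLpNorm_sub_le ((hφ n).sub hf) ((hψ n).sub hg) hp
  refine le_trans (le_of_eq ?_) this
  congr 1
  ext a; simp only [Pi.sub_apply]; ring

namespace H1Approx

variable {L : ℝ} {f fx fy g gx gy : ℝ × ℝ → ℝ} {φ ψ : ℕ → ℝ × ℝ → ℝ}

theorem sub (hf : H1Approx L f fx fy φ) (hg : H1Approx L g gx gy ψ) :
    H1Approx L (fun p => f p - g p) (fun p => fx p - gx p) (fun p => fy p - gy p)
      (fun n p => φ n p - ψ n p) where
  smooth n := (hf.smooth n).sub (hg.smooth n)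
  memLp := hf.memLp.sub hg.memLp
  memLp_x := hf.memLp_x.sub hg.memLp_x
  memLp_y := hf.memLp_y.sub hg.memLp_y
  tendsto := tendsto_eLpNorm_sub_sub (by norm_num)
    (fun n => (hf.smooth n).continuous.aestronglyMeasurable)
    (fun n => (hg.smooth n).continuous.aestronglyMeasurable) hf.memLp.1 hg.memLp.1
    hf.tendsto hg.tendsto
  tendsto_x := by
    simp_rw [dx_sub (hf.smooth _) (hg.smooth _)]
    exact tendsto_eLpNorm_sub_sub (by norm_num)
      (fun n => (continuous_dx (hf.smooth n)).aestronglyMeasurable)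
      (fun n => (continuous_dx (hg.smooth n)).aestronglyMeasurable) hf.memLp_x.1 hg.memLp_x.1
      hf.tendsto_x hg.tendsto_x
  tendsto_y := by
    simp_rw [dy_sub (hf.smooth _) (hg.smooth _)]
    exact tendsto_eLpNorm_sub_sub (by norm_num)
      (fun n => (continuous_dy (hf.smooth n)).aestronglyMeasurable)
      (fun n => (continuous_dy (hg.smooth n)).aestronglyMeasurable) hf.memLp_y.1 hg.memLp_y.1
      hf.tendsto_y hg.tendsto_y

theorem const {φ : ℝ × ℝ → ℝ} (hφ : ContDiff ℝ (⊤ : ℕ∞) φ) (L : ℝ) :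
    H1Approx L φ (dx φ) (dy φ) (fun _ => φ) where
  smooth _ := hφ
  memLp := memLp_square_of_continuous hφ.continuous L 2
  memLp_x := memLp_square_of_continuous (continuous_dx hφ) L 2
  memLp_y := memLp_square_of_continuous (continuous_dy hφ) L 2
  tendsto := by simp
  tendsto_x := by simp
  tendsto_y := by simp

theorem h1Sq_lt_top (hf : H1Approx L f fx fy φ) : h1Sq L f fx fy < ∞ := by
  rw [h1Sq_eq]
  exact ENNReal.add_lt_top.2 ⟨ENNReal.add_lt_top.2 ⟨ENNReal.pow_lt_top hf.memLp.2,
    ENNReal.pow_lt_top hf.memLp_x.2⟩, ENNReal.pow_lt_top hf.memLp_y.2⟩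

theorem tendsto_h1Sq (hf : H1Approx L f fx fy φ) :
    Tendsto (fun n => h1Sq L (φ n) (dx (φ n)) (dy (φ n))) atTop (𝓝 (h1Sq L f fx fy)) := by
  simp_rw [h1Sq_eq]
  refine ((ENNReal.Tendsto.pow ?_).add (ENNReal.Tendsto.pow ?_)).add (ENNReal.Tendsto.pow ?_)
  · exact tendsto_eLpNorm_of_sub (by norm_num)
      (fun n => (hf.smooth n).continuous.aestronglyMeasurable) hf.memLp hf.tendsto
  · exact tendsto_eLpNorm_of_sub (by norm_num)
      (fun n => (continuous_dx (hf.smooth n)).aestronglyMeasurable) hf.memLp_x hf.tendsto_x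
  · exact tendsto_eLpNorm_of_sub (by norm_num)
      (fun n => (continuous_dy (hf.smooth n)).aestronglyMeasurable) hf.memLp_y hf.tendsto_y

/-- Fatou's lemma along an almost everywhere convergent subsequence passes the smooth inequality to
the limit with the same constant. -/
theorem lintegral_pow_le (hL : 0 < L) (hf : H1Approx L f fx fy φ) (q : ℕ) :
    ∫⁻ p in square L, ‖f p‖ₑ ^ (2 * q) ≤
      volume (square L) * (q.factorial ^ 2 * (sobConst L * h1Sq L f fx fy) ^ q) := by
  obtain ⟨ns, hns, hae⟩ := (tendstoInMeasure_of_tendsto_eLpNorm (two_ne_zero)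
    (fun n => (hf.smooth n).continuous.aestronglyMeasurable) hf.memLp.1
    hf.tendsto).exists_seq_tendsto_ae
  have hC : sobConst L ≠ ∞ := by simp [sobConst, ENNReal.mul_eq_top]
  have hV : volume (square L) ≠ ∞ := by
    have := measure_ne_top (volume.restrict (square L)) Set.univ
    simpa using this
  have hlim : Tendsto (fun n => volume (square L) * (q.factorial ^ 2 *
      (sobConst L * h1Sq L (φ (ns n)) (dx (φ (ns n))) (dy (φ (ns n)))) ^ q)) atTop
      (𝓝 (volume (square L) * (q.factorial ^ 2 * (sobConst L * h1Sq L f fx fy) ^ q))) := by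
    refine ENNReal.Tendsto.const_mul (ENNReal.Tendsto.const_mul (ENNReal.Tendsto.pow
      (ENNReal.Tendsto.const_mul (hf.tendsto_h1Sq.comp hns.tendsto_atTop) (Or.inr hC)))
      (Or.inr ?_)) (Or.inr hV)
    exact ENNReal.pow_ne_top (ENNReal.natCast_ne_top _)
  calc ∫⁻ p in square L, ‖f p‖ₑ ^ (2 * q)
      = ∫⁻ p in square L, liminf (fun n => ‖φ (ns n) p‖ₑ ^ (2 * q)) atTop := by
        refine lintegral_congr_ae (hae.mono fun p hp => ?_)
        exact (ENNReal.Tendsto.pow hp.enorm).liminf_eq.symm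
    _ ≤ liminf (fun n => ∫⁻ p in square L, ‖φ (ns n) p‖ₑ ^ (2 * q)) atTop :=
        lintegral_liminf_le fun n => ((hf.smooth _).continuous.enorm.measurable).pow_const _
    _ ≤ liminf (fun n => volume (square L) * (q.factorial ^ 2 *
      (sobConst L * h1Sq L (φ (ns n)) (dx (φ (ns n))) (dy (φ (ns n)))) ^ q)) atTop :=
        liminf_le_liminf (Eventually.of_forall fun n =>
          lintegral_pow_le_factorial hL (hf.smooth (ns n)) q)
    _ = _ := hlim.liminf_eq

theorem memLp_four (hL : 0 < L) (hf : H1Approx L f fx fy φ) :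
    MemLp f 4 (volume.restrict (square L)) := by
  refine ⟨hf.memLp.1, ?_⟩
  have h := hf.lintegral_pow_le hL 2
  have h4 := eLpNorm_natCast_pow (μ := volume.restrict (square L)) (q := 4) (by norm_num) f
  rw [show 2 * 2 = 4 from rfl, ← h4] at h
  simp only [Nat.cast_ofNat] at h
  refine (ENNReal.pow_lt_top_iff.1 (h.trans_lt ?_)).resolve_right (by norm_num)
  have hV : volume (square L) < ∞ := by
    have := measure_lt_top (volume.restrict (square L)) Set.univ
    simpa using this
  have hC : sobConst L < ∞ := by simp [sobConst, ENNReal.mul_lt_top_iff]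
  have := hf.h1Sq_lt_top
  exact ENNReal.mul_lt_top hV (ENNReal.mul_lt_top (by norm_num [Nat.factorial])
    (ENNReal.pow_lt_top (ENNReal.mul_lt_top hC this)))

theorem tendsto_h1Sq_sub (hf : H1Approx L f fx fy φ) :
    Tendsto (fun n => h1Sq L (fun p => φ n p - f p) (fun p => dx (φ n) p - fx p)
      (fun p => dy (φ n) p - fy p)) atTop (𝓝 0) := by
  simp_rw [h1Sq_eq]
  simpa using ((ENNReal.Tendsto.pow (n := 2) hf.tendsto).add
    (ENNReal.Tendsto.pow (n := 2) hf.tendsto_x)).add (ENNReal.Tendsto.pow (n := 2) hf.tendsto_y)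

theorem tendsto_four (hL : 0 < L) (hf : H1Approx L f fx fy φ) :
    Tendsto (fun n => eLpNorm (fun p => φ n p - f p) 4 (volume.restrict (square L)))
      atTop (𝓝 0) := by
  have hV : volume (square L) ≠ ∞ := by
    have := measure_ne_top (volume.restrict (square L)) Set.univ
    simpa using this
  have hC : sobConst L ≠ ∞ := by simp [sobConst, ENNReal.mul_eq_top]
  have hlim : Tendsto (fun n => volume (square L) * (Nat.factorial 2 ^ 2 * (sobConst L *
      h1Sq L (fun p => φ n p - f p) (fun p => dx (φ n) p - fx p)
      (fun p => dy (φ n) p - fy p)) ^ 2)) atTop (𝓝 0) := by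
    have := ENNReal.Tendsto.const_mul (a := volume (square L)) (ENNReal.Tendsto.const_mul
      (a := (Nat.factorial 2 ^ 2 : ℝ≥0∞)) (ENNReal.Tendsto.pow (n := 2)
      (ENNReal.Tendsto.const_mul (a := sobConst L) hf.tendsto_h1Sq_sub (Or.inr hC)))
      (Or.inr (by norm_num [Nat.factorial]))) (Or.inr hV)
    simpa using this
  have h4 : Tendsto (fun n => eLpNorm (fun p => φ n p - f p) 4
      (volume.restrict (square L)) ^ 4) atTop (𝓝 0) := by
    refine tendsto_of_tendsto_of_tendsto_of_le_of_le tendsto_const_nhds hlim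
      (fun n => zero_le) (fun n => ?_)
    -- For fixed n the error φ n - f is itself an H¹ limit of smooth functions, so the embedding
    -- applies to it with q = 2.
    have h := ((const (hf.smooth n) L).sub hf).lintegral_pow_le hL 2
    have h4 := eLpNorm_natCast_pow (μ := volume.restrict (square L)) (q := 4) (by norm_num)
      (fun p => φ n p - f p)
    rw [show 2 * 2 = 4 from rfl, ← h4] at h
    exact h
  have := h4.ennrpow_const (1 / 4)
  simp only [one_div, ENNReal.zero_rpow_of_pos (show (0 : ℝ) < 4⁻¹ by norm_num)] at this
  refine this.congr fun n => ?_
  rw [← ENNReal.rpow_natCast, ← ENNReal.rpow_mul]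
  norm_num

/-- The restrictions to the sides are bounded in `L⁴`. -/
theorem exists_side_bound (hL : 0 < L) (hf : H1Approx L f fx fy φ) :
    ∃ B : ℝ≥0∞, B ≠ ∞ ∧ ∀ᶠ n in atTop, ∀ s ∈ Set.Icc 0 L,
      eLpNorm (fun y => φ n (s, y)) 4 (volume.restrict (Set.Ioo 0 L)) ≤ B ∧
      eLpNorm (fun x => φ n (x, s)) 4 (volume.restrict (Set.Ioo 0 L)) ≤ B := by
  have hV : volume (square L) < ∞ := by
    have := measure_lt_top (volume.restrict (square L)) Set.univ
    simpa using this
  have hC : sobConst L < ∞ := by simp [sobConst, ENNReal.mul_lt_top_iff]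
  set M := h1Sq L f fx fy + 1 with hM
  have hMt : M < ∞ := ENNReal.add_lt_top.2 ⟨hf.h1Sq_lt_top, by simp⟩
  set B := volume (square L) * (Nat.factorial 3 ^ 2 * (sobConst L * M) ^ 3) *
        (4 ^ 2 * sobConst L * M) with hB
  have hBt : B < ∞ := by
    have : (Nat.factorial 3 ^ 2 : ℝ≥0∞) < ∞ := by norm_num [Nat.factorial]
    have h16 : (4 ^ 2 : ℝ≥0∞) < ∞ := by norm_num
    exact ENNReal.mul_lt_top (ENNReal.mul_lt_top hV (ENNReal.mul_lt_top this
      (ENNReal.pow_lt_top (ENNReal.mul_lt_top hC hMt))))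
      (ENNReal.mul_lt_top (ENNReal.mul_lt_top h16 hC) hMt)
  -- Any finite bound suffices, so an eighth root is replaced by the crude B + 1.
  have hroot : ∀ x : ℝ≥0∞, (x ^ 4) ^ 2 ≤ B → x ≤ B + 1 := by
    intro x hx
    rcases le_total x 1 with h1 | h1
    · exact h1.trans le_add_self
    · rw [← pow_mul] at hx
      exact (le_self_pow₀ h1 (by norm_num)).trans (hx.trans le_self_add)
  refine ⟨B + 1, (ENNReal.add_lt_top.2 ⟨hBt, by simp⟩).ne, ?_⟩
  have hev : ∀ᶠ n in atTop, h1Sq L (φ n) (dx (φ n)) (dy (φ n)) ≤ M :=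
    (hf.tendsto_h1Sq.eventually_lt_const
      (ENNReal.lt_add_right hf.h1Sq_lt_top.ne one_ne_zero)).mono fun n hn => hn.le
  filter_upwards [hev] with n hn s hs
  have e := fun g : ℝ → ℝ => eLpNorm_natCast_pow (μ := volume.restrict (Set.Ioo 0 L))
    (q := 4) (by norm_num) g
  simp only [Nat.cast_ofNat] at e
  constructor
  · refine hroot _ ?_
    rw [e]
    refine (sq_lintegral_side_fst_le hL (hf.smooth n) hs).trans ?_
    rw [hB]; gcongr
  · refine hroot _ ?_
    rw [e]
    refine (sq_lintegral_side_snd_le hL (hf.smooth n) hs).trans ?_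
    rw [hB]; gcongr

end H1Approx

/-! ### Integration by parts for periodic functions -/

/-- `f`, with gradient `(fx, fy)`, is a limit in `H¹(Ω)` of smooth functions whose jumps between
opposite sides tend to `0` in `L²`. -/
def PerH1 (L : ℝ) (f fx fy : ℝ × ℝ → ℝ) : Prop :=
  ∃ φ : ℕ → ℝ × ℝ → ℝ, H1Approx L f fx fy φ ∧
    Tendsto (fun n => eLpNorm (fun y => φ n (L, y) - φ n (0, y)) 2
      (volume.restrict (Set.Ioo 0 L))) atTop (𝓝 0) ∧
    Tendsto (fun n => eLpNorm (fun x => φ n (x, L) - φ n (x, 0)) 2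
      (volume.restrict (Set.Ioo 0 L))) atTop (𝓝 0)

/-- Change one factor at a time: each term is an L² difference times two factors bounded in L⁴. This
is why L² convergence of the boundary jumps is enough. -/
theorem eLpNorm_mul_mul_sub_le {α : Type*} [MeasurableSpace α] {μ : Measure α}
    {a a' b b' c c' : α → ℝ} {B₁ B₂ B₃ : ℝ≥0∞}
    (ha : AEStronglyMeasurable a μ) (ha' : AEStronglyMeasurable a' μ)
    (hb : AEStronglyMeasurable b μ) (hb' : AEStronglyMeasurable b' μ)
    (hc : AEStronglyMeasurable c μ) (hc' : AEStronglyMeasurable c' μ)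
    (Ba' : eLpNorm a' 4 μ ≤ B₁) (Bb : eLpNorm b 4 μ ≤ B₂) (Bb' : eLpNorm b' 4 μ ≤ B₂)
    (Bc : eLpNorm c 4 μ ≤ B₃) :
    eLpNorm (fun x => a x * (b x * c x) - a' x * (b' x * c' x)) 1 μ ≤
      eLpNorm (fun x => a x - a' x) 2 μ * (B₂ * B₃) +
      eLpNorm (fun x => b x - b' x) 2 μ * (B₁ * B₃) +
      eLpNorm (fun x => c x - c' x) 2 μ * (B₁ * B₂) := by
  have e : (fun x => a x * (b x * c x) - a' x * (b' x * c' x)) =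
      (fun x => (a x - a' x) * (b x * c x)) + (fun x => (b x - b' x) * (a' x * c x)) +
        (fun x => (c x - c' x) * (a' x * b' x)) := by
    ext x; simp only [Pi.add_apply]; ring
  have m1 := (ha.sub ha').mul (hb.mul hc)
  have m2 := (hb.sub hb').mul (ha'.mul hc)
  have m3 := (hc.sub hc').mul (ha'.mul hb')
  rw [e]
  refine (eLpNorm_add_le (m1.add m2) m3 le_rfl).trans
    (add_le_add ((eLpNorm_add_le m1 m2 le_rfl).trans (add_le_add ?_ ?_)) ?_)
  · exact (eLpNorm_mul_mul_le (ha.sub ha') hb hc).trans (by gcongr; exact le_rfl)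
  · exact (eLpNorm_mul_mul_le (hb.sub hb') ha' hc).trans (by gcongr; exact le_rfl)
  · exact (eLpNorm_mul_mul_le (hc.sub hc') ha' hb').trans (by gcongr; exact le_rfl)

theorem integral_dx_eq {L : ℝ} (hL : 0 < L) {φ : ℝ × ℝ → ℝ} (hφ : ContDiff ℝ (⊤ : ℕ∞) φ) :
    ∫ p in square L, dx φ p = ∫ s in Set.Ioo 0 L, (φ (L, s) - φ (0, s)) := by
  have hint : Integrable (dx φ) (volume.restrict (square L)) :=
    memLp_one_iff_integrable.1 (memLp_square_of_continuous (continuous_dx hφ) L 1)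
  rw [volume_restrict_square] at hint ⊢
  rw [integral_prod_symm _ hint]
  refine integral_congr_ae (Eventually.of_forall fun s => ?_)
  simp only
  rw [← integral_Ioc_eq_integral_Ioo, ← intervalIntegral.integral_of_le hL.le]
  refine intervalIntegral.integral_eq_sub_of_hasDerivAt
    (f := fun r => φ (r, s)) (fun r _ => hasDerivAt_slice_fst hφ r s) ?_
  exact Continuous.intervalIntegrable ((continuous_dx hφ).comp (by fun_prop)) _ _

theorem dx_mul_mul {φ ψ χ : ℝ × ℝ → ℝ} (hφ : ContDiff ℝ (⊤ : ℕ∞) φ)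
    (hψ : ContDiff ℝ (⊤ : ℕ∞) ψ) (hχ : ContDiff ℝ (⊤ : ℕ∞) χ) (p : ℝ × ℝ) :
    dx (fun p => φ p * (ψ p * χ p)) p =
      dx φ p * (ψ p * χ p) + dx ψ p * (φ p * χ p) + dx χ p * (φ p * ψ p) := by
  have h1 : DifferentiableAt ℝ φ p := (hφ.differentiable (by simp)).differentiableAt
  have h2 : DifferentiableAt ℝ ψ p := (hψ.differentiable (by simp)).differentiableAt
  have h3 : DifferentiableAt ℝ χ p := (hχ.differentiable (by simp)).differentiableAt
  simp only [dx]
  rw [fderiv_fun_mul h1 (h2.fun_mul h3), fderiv_fun_mul h2 h3]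
  simp only [add_apply, smul_apply, smul_eq_mul]
  ring

/-- Integration by parts for the product of three periodic functions. -/
theorem PerH1.integral_mul_mul_x {L : ℝ} (hL : 0 < L) {f fx fy g gx gy h hx hy : ℝ × ℝ → ℝ}
    (hf : PerH1 L f fx fy) (hg : PerH1 L g gx gy) (hh : PerH1 L h hx hy) :
    (∫ p in square L, fx p * (g p * h p)) + (∫ p in square L, gx p * (f p * h p)) +
      (∫ p in square L, hx p * (f p * g p)) = 0 := by
  obtain ⟨φ, aφ, bφ, -⟩ := hf
  obtain ⟨ψ, aψ, bψ, -⟩ := hg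
  obtain ⟨χ, aχ, bχ, -⟩ := hh
  set μ := volume.restrict (square L)
  have c2 : ∀ {θ : ℕ → ℝ × ℝ → ℝ}, (∀ n, ContDiff ℝ (⊤ : ℕ∞) (θ n)) →
      ∀ n, MemLp (dx (θ n)) 2 μ :=
    fun hθ n => memLp_square_of_continuous (continuous_dx (hθ n)) L 2
  have c4 : ∀ {θ : ℕ → ℝ × ℝ → ℝ}, (∀ n, ContDiff ℝ (⊤ : ℕ∞) (θ n)) →
      ∀ n, MemLp (θ n) 4 μ :=
    fun hθ n => memLp_square_of_continuous (hθ n).continuous L 4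
  have t1 := tendsto_integral_mul_mul (c2 aφ.smooth) (c4 aψ.smooth) (c4 aχ.smooth)
    aφ.memLp_x (aψ.memLp_four hL) (aχ.memLp_four hL) aφ.tendsto_x (aψ.tendsto_four hL)
    (aχ.tendsto_four hL)
  have t2 := tendsto_integral_mul_mul (c2 aψ.smooth) (c4 aφ.smooth) (c4 aχ.smooth)
    aψ.memLp_x (aφ.memLp_four hL) (aχ.memLp_four hL) aψ.tendsto_x (aφ.tendsto_four hL)
    (aχ.tendsto_four hL)
  have t3 := tendsto_integral_mul_mul (c2 aχ.smooth) (c4 aφ.smooth) (c4 aψ.smooth)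
    aχ.memLp_x (aφ.memLp_four hL) (aψ.memLp_four hL) aχ.tendsto_x (aφ.tendsto_four hL)
    (aψ.tendsto_four hL)
  refine tendsto_nhds_unique ((t1.add t2).add t3) ?_
  have hsum : ∀ n, (∫ p in square L, dx (φ n) p * (ψ n p * χ n p)) +
      (∫ p in square L, dx (ψ n) p * (φ n p * χ n p)) +
      (∫ p in square L, dx (χ n) p * (φ n p * ψ n p)) =
      ∫ s in Set.Ioo 0 L, (φ n (L, s) * (ψ n (L, s) * χ n (L, s)) -
        φ n (0, s) * (ψ n (0, s) * χ n (0, s))) := by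
    intro n
    have i1 := integrable_mul_mul (c2 aφ.smooth n) (c4 aψ.smooth n) (c4 aχ.smooth n)
    have i2 := integrable_mul_mul (c2 aψ.smooth n) (c4 aφ.smooth n) (c4 aχ.smooth n)
    have i3 := integrable_mul_mul (c2 aχ.smooth n) (c4 aφ.smooth n) (c4 aψ.smooth n)
    have i12 : Integrable (fun p => dx (φ n) p * (ψ n p * χ n p) +
      dx (ψ n) p * (φ n p * χ n p)) μ := i1.add i2
    rw [← integral_add i1 i2, ← integral_add i12 i3]
    rw [← integral_dx_eq hL
      ((aφ.smooth n).mul ((aψ.smooth n).mul (aχ.smooth n)))]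
    refine integral_congr_ae (Eventually.of_forall fun p => ?_)
    exact (dx_mul_mul (aφ.smooth n) (aψ.smooth n) (aχ.smooth n) p).symm
  refine (tendsto_congr hsum).2 ?_
  obtain ⟨B₁, hB₁, e₁⟩ := aφ.exists_side_bound hL
  obtain ⟨B₂, hB₂, e₂⟩ := aψ.exists_side_bound hL
  obtain ⟨B₃, hB₃, e₃⟩ := aχ.exists_side_bound hL
  -- The boundary term vanishes in the limit: each jump tends to 0 in L², while the side values stay
  -- bounded in L⁴.
  have hlim := ((ENNReal.Tendsto.mul_const (b := B₂ * B₃) bφ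
    (Or.inr (ENNReal.mul_ne_top hB₂ hB₃))).add (ENNReal.Tendsto.mul_const (b := B₁ * B₃) bψ
    (Or.inr (ENNReal.mul_ne_top hB₁ hB₃)))).add (ENNReal.Tendsto.mul_const (b := B₁ * B₂) bχ
    (Or.inr (ENNReal.mul_ne_top hB₁ hB₂)))
  simp only [zero_mul, add_zero] at hlim
  have hcont : ∀ {θ : ℕ → ℝ × ℝ → ℝ}, (∀ n, ContDiff ℝ (⊤ : ℕ∞) (θ n)) → ∀ n r,
      Continuous (fun s => θ n (r, s)) :=
    fun hθ n r => (hθ n).continuous.comp (by fun_prop)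
  have m : ∀ {θ : ℕ → ℝ × ℝ → ℝ}, (∀ n, ContDiff ℝ (⊤ : ℕ∞) (θ n)) → ∀ n r,
      AEStronglyMeasurable (fun s => θ n (r, s)) (volume.restrict (Set.Ioo 0 L)) :=
    fun hθ n r => (hcont hθ n r).aestronglyMeasurable
  have hL1 : Tendsto (fun n => eLpNorm (fun s => φ n (L, s) * (ψ n (L, s) * χ n (L, s)) -
        φ n (0, s) * (ψ n (0, s) * χ n (0, s))) 1 (volume.restrict (Set.Ioo 0 L)))
        atTop (𝓝 0) := by
    refine tendsto_of_tendsto_of_tendsto_of_le_of_le' tendsto_const_nhds hlim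
      (Eventually.of_forall fun n => zero_le) ?_
    filter_upwards [e₁, e₂, e₃] with n h1 h2 h3
    have l0 : (0 : ℝ) ∈ Set.Icc 0 L := ⟨le_rfl, hL.le⟩
    have l1 : L ∈ Set.Icc 0 L := ⟨hL.le, le_rfl⟩
    exact eLpNorm_mul_mul_sub_le (m aφ.smooth n L) (m aφ.smooth n 0) (m aψ.smooth n L)
      (m aψ.smooth n 0) (m aχ.smooth n L) (m aχ.smooth n 0) (h1 0 l0).1 (h2 L l1).1
      (h2 0 l0).1 (h3 L l1).1
  have := tendsto_integral_of_L1' (μ := volume.restrict (Set.Ioo 0 L)) (l := atTop)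
    (fun _ => (0 : ℝ)) aestronglyMeasurable_const
    (F := fun n s => φ n (L, s) * (ψ n (L, s) * χ n (L, s)) - φ n (0, s) * (ψ n (0, s) * χ n (0, s)))
    (Eventually.of_forall fun n => memLp_one_iff_integrable.1 (memLp_Ioo_of_continuous
      (((hcont aφ.smooth n L).mul ((hcont aψ.smooth n L).mul (hcont aχ.smooth n L))).sub
      ((hcont aφ.smooth n 0).mul ((hcont aψ.smooth n 0).mul (hcont aχ.smooth n 0)))) L 1))
    (by simpa [Pi.sub_def] using hL1)
  simpa using this

theorem integral_dy_eq {L : ℝ} (hL : 0 < L) {φ : ℝ × ℝ → ℝ} (hφ : ContDiff ℝ (⊤ : ℕ∞) φ) :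
    ∫ p in square L, dy φ p = ∫ s in Set.Ioo 0 L, (φ (s, L) - φ (s, 0)) := by
  have hint : Integrable (dy φ) (volume.restrict (square L)) :=
    memLp_one_iff_integrable.1 (memLp_square_of_continuous (continuous_dy hφ) L 1)
  rw [volume_restrict_square] at hint ⊢
  rw [integral_prod _ hint]
  refine integral_congr_ae (Eventually.of_forall fun s => ?_)
  simp only
  rw [← integral_Ioc_eq_integral_Ioo, ← intervalIntegral.integral_of_le hL.le]
  refine intervalIntegral.integral_eq_sub_of_hasDerivAt
    (f := fun r => φ (s, r)) (fun r _ => hasDerivAt_slice_snd hφ s r) ?_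
  exact Continuous.intervalIntegrable ((continuous_dy hφ).comp (by fun_prop)) _ _

theorem dy_mul_mul {φ ψ χ : ℝ × ℝ → ℝ} (hφ : ContDiff ℝ (⊤ : ℕ∞) φ)
    (hψ : ContDiff ℝ (⊤ : ℕ∞) ψ) (hχ : ContDiff ℝ (⊤ : ℕ∞) χ) (p : ℝ × ℝ) :
    dy (fun p => φ p * (ψ p * χ p)) p =
      dy φ p * (ψ p * χ p) + dy ψ p * (φ p * χ p) + dy χ p * (φ p * ψ p) := by
  have h1 : DifferentiableAt ℝ φ p := (hφ.differentiable (by simp)).differentiableAt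
  have h2 : DifferentiableAt ℝ ψ p := (hψ.differentiable (by simp)).differentiableAt
  have h3 : DifferentiableAt ℝ χ p := (hχ.differentiable (by simp)).differentiableAt
  simp only [dy]
  rw [fderiv_fun_mul h1 (h2.fun_mul h3), fderiv_fun_mul h2 h3]
  simp only [add_apply, smul_apply, smul_eq_mul]
  ring

/-- Integration by parts for the product of three periodic functions. -/
theorem PerH1.integral_mul_mul_y {L : ℝ} (hL : 0 < L) {f fx fy g gx gy h hx hy : ℝ × ℝ → ℝ}
    (hf : PerH1 L f fx fy) (hg : PerH1 L g gx gy) (hh : PerH1 L h hx hy) :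
    (∫ p in square L, fy p * (g p * h p)) + (∫ p in square L, gy p * (f p * h p)) +
      (∫ p in square L, hy p * (f p * g p)) = 0 := by
  obtain ⟨φ, aφ, -, bφ⟩ := hf
  obtain ⟨ψ, aψ, -, bψ⟩ := hg
  obtain ⟨χ, aχ, -, bχ⟩ := hh
  set μ := volume.restrict (square L)
  have c2 : ∀ {θ : ℕ → ℝ × ℝ → ℝ}, (∀ n, ContDiff ℝ (⊤ : ℕ∞) (θ n)) →
      ∀ n, MemLp (dy (θ n)) 2 μ :=
    fun hθ n => memLp_square_of_continuous (continuous_dy (hθ n)) L 2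
  have c4 : ∀ {θ : ℕ → ℝ × ℝ → ℝ}, (∀ n, ContDiff ℝ (⊤ : ℕ∞) (θ n)) →
      ∀ n, MemLp (θ n) 4 μ :=
    fun hθ n => memLp_square_of_continuous (hθ n).continuous L 4
  have t1 := tendsto_integral_mul_mul (c2 aφ.smooth) (c4 aψ.smooth) (c4 aχ.smooth)
    aφ.memLp_y (aψ.memLp_four hL) (aχ.memLp_four hL) aφ.tendsto_y (aψ.tendsto_four hL)
    (aχ.tendsto_four hL)
  have t2 := tendsto_integral_mul_mul (c2 aψ.smooth) (c4 aφ.smooth) (c4 aχ.smooth)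
    aψ.memLp_y (aφ.memLp_four hL) (aχ.memLp_four hL) aψ.tendsto_y (aφ.tendsto_four hL)
    (aχ.tendsto_four hL)
  have t3 := tendsto_integral_mul_mul (c2 aχ.smooth) (c4 aφ.smooth) (c4 aψ.smooth)
    aχ.memLp_y (aφ.memLp_four hL) (aψ.memLp_four hL) aχ.tendsto_y (aφ.tendsto_four hL)
    (aψ.tendsto_four hL)
  refine tendsto_nhds_unique ((t1.add t2).add t3) ?_
  have hsum : ∀ n, (∫ p in square L, dy (φ n) p * (ψ n p * χ n p)) +
      (∫ p in square L, dy (ψ n) p * (φ n p * χ n p)) +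
      (∫ p in square L, dy (χ n) p * (φ n p * ψ n p)) =
      ∫ s in Set.Ioo 0 L, (φ n (s, L) * (ψ n (s, L) * χ n (s, L)) -
        φ n (s, 0) * (ψ n (s, 0) * χ n (s, 0))) := by
    intro n
    have i1 := integrable_mul_mul (c2 aφ.smooth n) (c4 aψ.smooth n) (c4 aχ.smooth n)
    have i2 := integrable_mul_mul (c2 aψ.smooth n) (c4 aφ.smooth n) (c4 aχ.smooth n)
    have i3 := integrable_mul_mul (c2 aχ.smooth n) (c4 aφ.smooth n) (c4 aψ.smooth n)
    have i12 : Integrable (fun p => dy (φ n) p * (ψ n p * χ n p) +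
      dy (ψ n) p * (φ n p * χ n p)) μ := i1.add i2
    rw [← integral_add i1 i2, ← integral_add i12 i3]
    rw [← integral_dy_eq hL
      ((aφ.smooth n).mul ((aψ.smooth n).mul (aχ.smooth n)))]
    refine integral_congr_ae (Eventually.of_forall fun p => ?_)
    exact (dy_mul_mul (aφ.smooth n) (aψ.smooth n) (aχ.smooth n) p).symm
  refine (tendsto_congr hsum).2 ?_
  obtain ⟨B₁, hB₁, e₁⟩ := aφ.exists_side_bound hL
  obtain ⟨B₂, hB₂, e₂⟩ := aψ.exists_side_bound hL
  obtain ⟨B₃, hB₃, e₃⟩ := aχ.exists_side_bound hL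
  have hlim := ((ENNReal.Tendsto.mul_const (b := B₂ * B₃) bφ
    (Or.inr (ENNReal.mul_ne_top hB₂ hB₃))).add (ENNReal.Tendsto.mul_const (b := B₁ * B₃) bψ
    (Or.inr (ENNReal.mul_ne_top hB₁ hB₃)))).add (ENNReal.Tendsto.mul_const (b := B₁ * B₂) bχ
    (Or.inr (ENNReal.mul_ne_top hB₁ hB₂)))
  simp only [zero_mul, add_zero] at hlim
  have hcont : ∀ {θ : ℕ → ℝ × ℝ → ℝ}, (∀ n, ContDiff ℝ (⊤ : ℕ∞) (θ n)) → ∀ n r,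
      Continuous (fun s => θ n (s, r)) :=
    fun hθ n r => (hθ n).continuous.comp (by fun_prop)
  have m : ∀ {θ : ℕ → ℝ × ℝ → ℝ}, (∀ n, ContDiff ℝ (⊤ : ℕ∞) (θ n)) → ∀ n r,
      AEStronglyMeasurable (fun s => θ n (s, r)) (volume.restrict (Set.Ioo 0 L)) :=
    fun hθ n r => (hcont hθ n r).aestronglyMeasurable
  have hL1 : Tendsto (fun n => eLpNorm (fun s => φ n (s, L) * (ψ n (s, L) * χ n (s, L)) -
        φ n (s, 0) * (ψ n (s, 0) * χ n (s, 0))) 1 (volume.restrict (Set.Ioo 0 L)))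
        atTop (𝓝 0) := by
    refine tendsto_of_tendsto_of_tendsto_of_le_of_le' tendsto_const_nhds hlim
      (Eventually.of_forall fun n => zero_le) ?_
    filter_upwards [e₁, e₂, e₃] with n h1 h2 h3
    have l0 : (0 : ℝ) ∈ Set.Icc 0 L := ⟨le_rfl, hL.le⟩
    have l1 : L ∈ Set.Icc 0 L := ⟨hL.le, le_rfl⟩
    exact eLpNorm_mul_mul_sub_le (m aφ.smooth n L) (m aφ.smooth n 0) (m aψ.smooth n L)
      (m aψ.smooth n 0) (m aχ.smooth n L) (m aχ.smooth n 0) (h1 0 l0).2 (h2 L l1).2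
      (h2 0 l0).2 (h3 L l1).2
  have := tendsto_integral_of_L1' (μ := volume.restrict (Set.Ioo 0 L)) (l := atTop)
    (fun _ => (0 : ℝ)) aestronglyMeasurable_const
    (F := fun n s => φ n (s, L) * (ψ n (s, L) * χ n (s, L)) - φ n (s, 0) * (ψ n (s, 0) * χ n (s, 0)))
    (Eventually.of_forall fun n => memLp_one_iff_integrable.1 (memLp_Ioo_of_continuous
      (((hcont aφ.smooth n L).mul ((hcont aψ.smooth n L).mul (hcont aχ.smooth n L))).sub
      ((hcont aφ.smooth n 0).mul ((hcont aψ.smooth n 0).mul (hcont aχ.smooth n 0)))) L 1))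
    (by simpa [Pi.sub_def] using hL1)
  simpa using this

/-! ### Integrability and differences of periodic `H¹` functions -/

namespace PerH1

variable {L : ℝ} {f fx fy g gx gy : ℝ × ℝ → ℝ}

theorem memLp (hf : PerH1 L f fx fy) : MemLp f 2 (volume.restrict (square L)) := by
  obtain ⟨φ, h, -⟩ := hf; exact h.memLp

theorem memLp_x (hf : PerH1 L f fx fy) : MemLp fx 2 (volume.restrict (square L)) := by
  obtain ⟨φ, h, -⟩ := hf; exact h.memLp_x

theorem memLp_y (hf : PerH1 L f fx fy) : MemLp fy 2 (volume.restrict (square L)) := by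
  obtain ⟨φ, h, -⟩ := hf; exact h.memLp_y

theorem memLp_four (hL : 0 < L) (hf : PerH1 L f fx fy) :
    MemLp f 4 (volume.restrict (square L)) := by
  obtain ⟨φ, h, -⟩ := hf; exact h.memLp_four hL

theorem sub (hf : PerH1 L f fx fy) (hg : PerH1 L g gx gy) :
    PerH1 L (fun p => f p - g p) (fun p => fx p - gx p) (fun p => fy p - gy p) := by
  obtain ⟨φ, aφ, bφ, cφ⟩ := hf
  obtain ⟨ψ, aψ, bψ, cψ⟩ := hg
  have hm : ∀ {θ : ℕ → ℝ × ℝ → ℝ}, (∀ n, ContDiff ℝ (⊤ : ℕ∞) (θ n)) → ∀ {γ : ℝ → ℝ × ℝ},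
      Continuous γ → ∀ n, AEStronglyMeasurable (fun s => θ n (γ s))
        (volume.restrict (Set.Ioo 0 L)) :=
    fun hθ _ hγ n => ((hθ n).continuous.comp hγ).aestronglyMeasurable
  refine ⟨_, aφ.sub aψ, ?_, ?_⟩
  · have := tendsto_eLpNorm_sub_sub (p := 2) (μ := volume.restrict (Set.Ioo 0 L)) (by norm_num)
      (φ := fun n s => φ n (L, s) - φ n (0, s)) (ψ := fun n s => ψ n (L, s) - ψ n (0, s))
      (f := fun _ => 0) (g := fun _ => 0)
      (fun n => (hm aφ.smooth (by fun_prop) n).sub (hm aφ.smooth (by fun_prop) n))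
      (fun n => (hm aψ.smooth (by fun_prop) n).sub (hm aψ.smooth (by fun_prop) n))
      aestronglyMeasurable_const aestronglyMeasurable_const
      (by simpa using bφ) (by simpa using bψ)
    refine this.congr fun n => ?_
    congr 1; ext s; ring
  · have := tendsto_eLpNorm_sub_sub (p := 2) (μ := volume.restrict (Set.Ioo 0 L)) (by norm_num)
      (φ := fun n s => φ n (s, L) - φ n (s, 0)) (ψ := fun n s => ψ n (s, L) - ψ n (s, 0))
      (f := fun _ => 0) (g := fun _ => 0)
      (fun n => (hm aφ.smooth (by fun_prop) n).sub (hm aφ.smooth (by fun_prop) n))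
      (fun n => (hm aψ.smooth (by fun_prop) n).sub (hm aψ.smooth (by fun_prop) n))
      aestronglyMeasurable_const aestronglyMeasurable_const
      (by simpa using cφ) (by simpa using cψ)
    refine this.congr fun n => ?_
    congr 1; ext s; ring

/-- Taken with c = 1 as a third factor, this reduces the trilinear integration by parts to the
bilinear one. -/
theorem const (L c : ℝ) : PerH1 L (fun _ => c) (fun _ => 0) (fun _ => 0) := by
  have h := H1Approx.const (contDiff_const (c := c) (𝕜 := ℝ) (E := ℝ × ℝ)) L
  have e1 : dx (fun _ => c) = fun _ => 0 := by ext p; simp [dx]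
  have e2 : dy (fun _ => c) = fun _ => 0 := by ext p; simp [dy]
  rw [e1, e2] at h
  exact ⟨_, h, by simp, by simp⟩

end PerH1

/-- The integral over `Ω` of a product of three functions. -/
def tri (L : ℝ) (a b c : ℝ × ℝ → ℝ) : ℝ := ∫ p in square L, a p * (b p * c p)

theorem tri_swap (L : ℝ) (a b c : ℝ × ℝ → ℝ) : tri L a b c = tri L a c b := by
  simp only [tri, mul_comm (b _)]

theorem tri_left (L : ℝ) (a b c : ℝ × ℝ → ℝ) : tri L a b c = tri L b a c := by
  simp only [tri, mul_left_comm (a _)]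

/-- A family `D a b = ∂ₓᵃ ∂ᵧᵇ f` of functions, `a + b ≤ m`, with periodic traces. -/
def IsPerJet (L : ℝ) (m : ℕ) (D : ℕ → ℕ → ℝ × ℝ → ℝ) : Prop :=
  ∀ a b, a + b + 1 ≤ m → PerH1 L (D a b) (D (a + 1) b) (D a (b + 1))

/-! ### Cancellations in the Poisson bracket -/

section identities

variable {L : ℝ} {E U X W : ℕ → ℕ → ℝ × ℝ → ℝ}

theorem PerH1.tri_x (hL : 0 < L) {f fx fy g gx gy h hx hy : ℝ × ℝ → ℝ}
    (hf : PerH1 L f fx fy) (hg : PerH1 L g gx gy) (hh : PerH1 L h hx hy) :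
    tri L fx g h + tri L gx f h + tri L hx f g = 0 :=
  hf.integral_mul_mul_x hL hg hh

theorem PerH1.tri_y (hL : 0 < L) {f fx fy g gx gy h hx hy : ℝ × ℝ → ℝ}
    (hf : PerH1 L f fx fy) (hg : PerH1 L g gx gy) (hh : PerH1 L h hx hy) :
    tri L fy g h + tri L gy f h + tri L hy f g = 0 :=
  hf.integral_mul_mul_y hL hg hh

theorem PerH1.integral_mul_x (hL : 0 < L) {f fx fy g gx gy : ℝ × ℝ → ℝ}
    (hf : PerH1 L f fx fy) (hg : PerH1 L g gx gy) :
    (∫ p in square L, fx p * g p) + ∫ p in square L, f p * gx p = 0 := by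
  have := hf.integral_mul_mul_x hL hg (PerH1.const L 1)
  simpa [mul_comm (gx _)] using this

theorem PerH1.integral_mul_y (hL : 0 < L) {f fx fy g gx gy : ℝ × ℝ → ℝ}
    (hf : PerH1 L f fx fy) (hg : PerH1 L g gx gy) :
    (∫ p in square L, fy p * g p) + ∫ p in square L, f p * gy p = 0 := by
  have := hf.integral_mul_mul_y hL hg (PerH1.const L 1)
  simpa [mul_comm (gy _)] using this

/-- `∫ η {η, w} = 0`. -/
theorem tri_bracket_self (hL : 0 < L) (hE : IsPerJet L 3 E) (hW : IsPerJet L 1 W) :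
    tri L (W 0 1) (E 0 0) (E 1 0) - tri L (W 1 0) (E 0 0) (E 0 1) = 0 := by
  -- Moving the derivative off w leaves ∫ w η η_xy and ∫ w η_x η_y in both identities; they cancel
  -- on subtraction.
  have h1 := (hW 0 0 le_rfl).tri_y hL (hE 0 0 (by norm_num)) (hE 1 0 (by norm_num))
  have h2 := (hW 0 0 le_rfl).tri_x hL (hE 0 0 (by norm_num)) (hE 0 1 (by norm_num))
  simp only [zero_add] at h1 h2
  have e : tri L (E 0 1) (W 0 0) (E 1 0) = tri L (E 1 0) (W 0 0) (E 0 1) := by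
    rw [tri_left, tri_swap, tri_left]
  linarith

/-- The quadratic form in `∇η` to which `∫ η {u, ξ}` reduces for `ξ = η - Δη`. -/
theorem tri_bracket_eq (hL : 0 < L) (hE : IsPerJet L 3 E) (hU : IsPerJet L 3 U)
    (hX : IsPerJet L 1 X)
    (hXE : X 0 0 =ᵐ[volume.restrict (square L)] fun p => E 0 0 p - (E 2 0 p + E 0 2 p)) :
    tri L (X 0 1) (E 0 0) (U 1 0) - tri L (X 1 0) (E 0 0) (U 0 1) =
      tri L (U 1 1) (E 1 0) (E 1 0) - tri L (U 1 1) (E 0 1) (E 0 1) +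
        (tri L (U 0 2) (E 1 0) (E 0 1) - tri L (U 2 0) (E 1 0) (E 0 1)) := by
  have split : ∀ b c, MemLp b 4 (volume.restrict (square L)) →
      MemLp c 4 (volume.restrict (square L)) →
      tri L (X 0 0) b c = tri L (E 0 0) b c - (tri L (E 2 0) b c + tri L (E 0 2) b c) := by
    intro b c hb hc
    have i0 := integrable_mul_mul (hE 0 0 (by norm_num)).memLp hb hc
    have i1 := integrable_mul_mul (hE 1 0 (by norm_num)).memLp_x hb hc
    have i2 := integrable_mul_mul (hE 0 1 (by norm_num)).memLp_y hb hc
    have i12 : Integrable (fun p => E 2 0 p * (b p * c p) + E 0 2 p * (b p * c p))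
      (volume.restrict (square L)) := i1.add i2
    simp only [tri]
    rw [← integral_add i1 i2, ← integral_sub i0 i12]
    refine integral_congr_ae (hXE.mono fun p hp => ?_)
    simp only [hp]; ring
  have e00 := hE 0 0 (by norm_num)
  have e10 := hE 1 0 (by norm_num)
  have e01 := hE 0 1 (by norm_num)
  have u10 := hU 1 0 (by norm_num)
  have u01 := hU 0 1 (by norm_num)
  have x00 := hX 0 0 (by norm_num)
  simp only [zero_add, Nat.reduceAdd] at e00 e10 e01 u10 u01 x00
  -- Removing the derivatives from ξ gives ∫ ξ (η_x u_y - η_y u_x), since the terms with u_xy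
  -- cancel. Then ξ = η - Δη is substituted, and `b1`, `b2` show that its η part contributes
  -- nothing.
  have a1 := x00.tri_y hL e00 u10
  have a2 := x00.tri_x hL e00 u01
  have s1 := split _ _ (e01.memLp_four hL) (u10.memLp_four hL)
  have s2 := split _ _ (e10.memLp_four hL) (u01.memLp_four hL)
  have b1 := e00.tri_y hL e00 u10
  have b2 := e00.tri_x hL e00 u01
  -- What remains is Δη times a first derivative of η and one of u. Integrating by parts moves a
  -- derivative onto ∇u; the mixed terms with η_xy that appear are eliminated by `c1'` and `c4'`.
  have c1 := e10.tri_x hL e01 u10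
  have c1' := e10.tri_y hL e10 u10
  have c2 := e01.tri_y hL e01 u10
  have c3 := e10.tri_x hL e10 u01
  have c4 := e01.tri_y hL e10 u01
  have c4' := e01.tri_x hL e01 u01
  rw [tri_left L (E 0 1) (X 0 0)] at a1
  rw [tri_left L (E 1 0) (X 0 0)] at a2
  rw [tri_left L (E 0 1) (E 0 0)] at b1
  rw [tri_left L (E 1 0) (E 0 0)] at b2
  rw [tri_swap L _ (E 0 1) (E 1 0)] at c4
  linarith

end identities

/-! ### The borderline estimate of `∫ |f| g²` -/

theorem PerH1.lintegral_pow_le {L : ℝ} {f fx fy : ℝ × ℝ → ℝ} (hL : 0 < L)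
    (hf : PerH1 L f fx fy) (q : ℕ) :
    ∫⁻ p in square L, ‖f p‖ₑ ^ (2 * q) ≤
      volume (square L) * (q.factorial ^ 2 * (sobConst L * h1Sq L f fx fy) ^ q) := by
  obtain ⟨φ, h, -⟩ := hf; exact h.lintegral_pow_le hL q

/-- A split at height l: where x exceeds l, the factor (x / l)^m is at least 1. It trades an L^∞
bound for a high moment. -/
theorem le_add_inv_pow_mul_pow {l : ℝ≥0∞} (h0 : l ≠ 0) (ht : l ≠ ∞) (m : ℕ) (x : ℝ≥0∞) :
    x ≤ l + (l ^ m)⁻¹ * x ^ (m + 1) := by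
  rcases le_total x l with h | h
  · exact h.trans le_self_add
  · refine le_trans ?_ le_add_self
    calc x = (l ^ m)⁻¹ * (l ^ m * x) := by
          rw [← mul_assoc, ENNReal.inv_mul_cancel (pow_ne_zero _ h0) (ENNReal.pow_ne_top ht),
            one_mul]
      _ ≤ (l ^ m)⁻¹ * (x ^ m * x) := by gcongr
      _ = _ := by rw [pow_succ]

/-- The constant of `lintegral_mul_sq_le`. -/
def logConst (L : ℝ) : ℝ≥0∞ := 2 * volume (square L) * sobConst L

/-- For `f, g ∈ H¹(Ω)`, the integral `∫ |f| g²` is bounded by `4 n K ∫ g²` up to an error that is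
exponentially small in `n`. -/
theorem lintegral_mul_sq_le {L : ℝ} (hL : 0 < L) {f fx fy g gx gy : ℝ × ℝ → ℝ}
    (hf : PerH1 L f fx fy) (hg : PerH1 L g gx gy) {k : ℝ≥0∞} (k0 : k ≠ 0) (kt : k ≠ ∞)
    (hk : sobConst L * h1Sq L f fx fy ≤ k ^ 2) (m : ℕ) :
    ∫⁻ p in square L, ‖f p‖ₑ * ‖g p‖ₑ ^ 2 ≤
      4 * (m + 1) * k * ((∫⁻ p in square L, ‖g p‖ₑ ^ 2) +
        (4 ^ (m + 1))⁻¹ * (logConst L * h1Sq L g gx gy)) := by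
  set μ := volume.restrict (square L)
  have mf : AEMeasurable (fun p => ‖f p‖ₑ) μ := hf.memLp.1.enorm
  have mg : AEMeasurable (fun p => ‖g p‖ₑ) μ := hg.memLp.1.enorm
  -- In this height m + 1 absorbs the factorial growth of the moments, k absorbs the H¹ norm of f,
  -- and the factor 4 is left over to produce the gain 4^(-(m+1)) in `hlk`.
  set l : ℝ≥0∞ := 4 * (m + 1) * k with hl
  have m1t : ((m : ℝ≥0∞) + 1) ≠ ∞ := by simp
  have l0 : l ≠ 0 := mul_ne_zero (mul_ne_zero (by norm_num) (by simp)) k0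
  have lt : l ≠ ∞ := ENNReal.mul_ne_top (ENNReal.mul_ne_top (by norm_num) m1t) kt
  set P := ∫⁻ p in square L, ‖f p‖ₑ ^ (m + 1) * ‖g p‖ₑ ^ 2 with hP
  -- Cauchy–Schwarz pairs the moment of f of order 2(m + 1) with the fourth moment of g; the latter
  -- is the case q = 2, whence the factor 2 = 2!.
  have hPle : P ≤ (2 * volume (square L)) * ((m + 1).factorial * k ^ (m + 1)) *
      (sobConst L * h1Sq L g gx gy) := by
    refine (ENNReal.pow_le_pow_left_iff two_ne_zero).mp ?_
    refine (sq_lintegral_mul_le μ (mf.pow_const _) (mg.pow_const _)).trans ?_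
    simp only [← pow_mul]
    have h1 := hf.lintegral_pow_le hL (m + 1)
    have h2 := hg.lintegral_pow_le hL 2
    rw [mul_comm (m + 1) 2]
    calc _ ≤ _ * _ := mul_le_mul' h1 h2
      _ ≤ (volume (square L) * ((m + 1).factorial ^ 2 * (k ^ 2) ^ (m + 1))) * _ := by gcongr
      _ = _ := by
        rw [show Nat.factorial 2 = 2 from rfl]; push_cast; ring
  have hfac : ((m + 1).factorial : ℝ≥0∞) ≤ (m + 1) ^ (m + 1) := by
    have := Nat.factorial_le_pow (m + 1)
    exact_mod_cast this
  have h4 : (4 : ℝ≥0∞) ^ (m + 1) ≠ 0 := by positivity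
  have h4t : (4 : ℝ≥0∞) ^ (m + 1) ≠ ∞ := ENNReal.pow_ne_top (by norm_num)
  have hlk : (l ^ m)⁻¹ * (((m : ℝ≥0∞) + 1) ^ (m + 1) * k ^ (m + 1)) = l * (4 ^ (m + 1))⁻¹ := by
    have : ((m : ℝ≥0∞) + 1) ^ (m + 1) * k ^ (m + 1) = l ^ m * l * (4 ^ (m + 1))⁻¹ := by
      rw [← pow_succ, hl, mul_pow, mul_pow]
      rw [mul_assoc (4 ^ (m + 1)), mul_comm (4 ^ (m + 1)), mul_assoc,
        ENNReal.mul_inv_cancel h4 h4t, mul_one]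
    rw [this, mul_assoc, ← mul_assoc,
      ENNReal.inv_mul_cancel (pow_ne_zero _ l0) (ENNReal.pow_ne_top lt), one_mul]
  calc ∫⁻ p in square L, ‖f p‖ₑ * ‖g p‖ₑ ^ 2
      ≤ ∫⁻ p in square L, (l * ‖g p‖ₑ ^ 2 + (l ^ m)⁻¹ * (‖f p‖ₑ ^ (m + 1) * ‖g p‖ₑ ^ 2)) := by
        refine lintegral_mono fun p => ?_
        calc ‖f p‖ₑ * ‖g p‖ₑ ^ 2 ≤ (l + (l ^ m)⁻¹ * ‖f p‖ₑ ^ (m + 1)) * ‖g p‖ₑ ^ 2 := by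
              gcongr; exact le_add_inv_pow_mul_pow l0 lt m _
          _ = _ := by ring
    _ = l * (∫⁻ p in square L, ‖g p‖ₑ ^ 2) + (l ^ m)⁻¹ * P := by
        have mP : AEMeasurable (fun p => ‖f p‖ₑ ^ (m + 1) * ‖g p‖ₑ ^ 2) μ :=
          (mf.pow_const _).mul (mg.pow_const _)
        rw [lintegral_add_left' ((mg.pow_const _).const_mul _), lintegral_const_mul'' _
          (mg.pow_const _), lintegral_const_mul'' _ mP]
    _ ≤ l * (∫⁻ p in square L, ‖g p‖ₑ ^ 2) + (l ^ m)⁻¹ * ((2 * volume (square L)) *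
          ((m + 1) ^ (m + 1) * k ^ (m + 1)) * (sobConst L * h1Sq L g gx gy)) := by
        gcongr
        refine hPle.trans ?_
        gcongr
    _ = l * (∫⁻ p in square L, ‖g p‖ₑ ^ 2) + ((l ^ m)⁻¹ *
          ((m + 1) ^ (m + 1) * k ^ (m + 1))) * (logConst L * h1Sq L g gx gy) := by
        rw [logConst]; ring
    _ = _ := by rw [hlk]; ring

/-! ### Energy identities at a fixed time -/

/-- The inner product of `L²(Ω)`. -/
def bil (L : ℝ) (a b : ℝ × ℝ → ℝ) : ℝ := ∫ p in square L, a p * b p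

theorem bil_comm (L : ℝ) (a b : ℝ × ℝ → ℝ) : bil L a b = bil L b a := by
  simp only [bil, mul_comm (a _)]

theorem bil_self_nonneg (L : ℝ) (a : ℝ × ℝ → ℝ) : 0 ≤ bil L a a :=
  integral_nonneg fun p => mul_self_nonneg (a p)

theorem integrable_mul_of_memLp_two {α : Type*} [MeasurableSpace α] {μ : Measure α}
    {a b : α → ℝ} (ha : MemLp a 2 μ) (hb : MemLp b 2 μ) : Integrable (fun x => a x * b x) μ :=
  ha.integrable_mul hb

theorem lintegral_enorm_sq {L : ℝ} {g : ℝ × ℝ → ℝ}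
    (hg : MemLp g 2 (volume.restrict (square L))) :
    ∫⁻ p in square L, ‖g p‖ₑ ^ 2 = ENNReal.ofReal (bil L g g) := by
  rw [bil, ofReal_integral_eq_lintegral_ofReal (integrable_mul_of_memLp_two hg hg)
    (Eventually.of_forall fun p => mul_self_nonneg (g p))]
  refine lintegral_congr fun p => ?_
  rw [← ofReal_norm, ← ENNReal.ofReal_pow (norm_nonneg _), Real.norm_eq_abs, sq_abs, sq]

theorem PerH1.h1Sq_eq {L : ℝ} {f fx fy : ℝ × ℝ → ℝ} (hf : PerH1 L f fx fy) :
    h1Sq L f fx fy = ENNReal.ofReal (bil L f f + bil L fx fx + bil L fy fy) := by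
  rw [h1Sq, lintegral_enorm_sq hf.memLp, lintegral_enorm_sq hf.memLp_x,
    lintegral_enorm_sq hf.memLp_y, ENNReal.ofReal_add, ENNReal.ofReal_add] <;>
  first
    | exact bil_self_nonneg _ _
    | exact add_nonneg (bil_self_nonneg _ _) (bil_self_nonneg _ _)

theorem PerH1.bil_x {L : ℝ} (hL : 0 < L) {f fx fy g gx gy : ℝ × ℝ → ℝ}
    (hf : PerH1 L f fx fy) (hg : PerH1 L g gx gy) : bil L fx g + bil L f gx = 0 :=
  hf.integral_mul_x hL hg

theorem PerH1.bil_y {L : ℝ} (hL : 0 < L) {f fx fy g gx gy : ℝ × ℝ → ℝ}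
    (hf : PerH1 L f fx fy) (hg : PerH1 L g gx gy) : bil L fy g + bil L f gy = 0 :=
  hf.integral_mul_y hL hg

section energy

variable {L : ℝ} {E U X W : ℕ → ℕ → ℝ × ℝ → ℝ}

theorem bil_helmholtz (hE : IsPerJet L 3 E)
    (hXE : X 0 0 =ᵐ[volume.restrict (square L)] fun p => E 0 0 p - (E 2 0 p + E 0 2 p))
    {b : ℝ × ℝ → ℝ} (hb : MemLp b 2 (volume.restrict (square L))) :
    bil L (X 0 0) b = bil L (E 0 0) b - (bil L (E 2 0) b + bil L (E 0 2) b) := by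
  have i0 := integrable_mul_of_memLp_two (hE 0 0 (by norm_num)).memLp hb
  have i1 : Integrable (fun p => E 2 0 p * b p) (volume.restrict (square L)) :=
    integrable_mul_of_memLp_two (hE 1 0 (by norm_num)).memLp_x hb
  have i2 : Integrable (fun p => E 0 2 p * b p) (volume.restrict (square L)) :=
    integrable_mul_of_memLp_two (hE 0 1 (by norm_num)).memLp_y hb
  have i12 : Integrable (fun p => E 2 0 p * b p + E 0 2 p * b p)
    (volume.restrict (square L)) := i1.add i2
  simp only [bil]
  rw [← integral_add i1 i2, ← integral_sub i0 i12]
  refine integral_congr_ae (hXE.mono fun p hp => ?_)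
  simp only [hp]; ring

/-- `⟨η, (I - Δ) η⟩ = ‖η‖² + ‖∇η‖²`. -/
theorem bil_helmholtz_self (hL : 0 < L) (hE : IsPerJet L 3 E)
    (hXE : X 0 0 =ᵐ[volume.restrict (square L)] fun p => E 0 0 p - (E 2 0 p + E 0 2 p)) :
    bil L (E 0 0) (X 0 0) =
      bil L (E 0 0) (E 0 0) + bil L (E 1 0) (E 1 0) + bil L (E 0 1) (E 0 1) := by
  have e00 := hE 0 0 (by norm_num)
  have h := bil_helmholtz hE hXE e00.memLp
  have h1 := (hE 1 0 (by norm_num)).bil_x hL e00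
  have h2 := (hE 0 1 (by norm_num)).bil_y hL e00
  simp only [zero_add, Nat.reduceAdd] at h1 h2
  rw [bil_comm]
  linarith

/-- Second derivatives are controlled by the Helmholtz operator. -/
theorem bil_second_le (hL : 0 < L) (hE : IsPerJet L 3 E) (hX : IsPerJet L 1 X)
    (hXE : X 0 0 =ᵐ[volume.restrict (square L)] fun p => E 0 0 p - (E 2 0 p + E 0 2 p)) :
    (bil L (E 1 0) (E 1 0) + bil L (E 2 0) (E 2 0) + bil L (E 1 1) (E 1 1)) +
      (bil L (E 0 1) (E 0 1) + bil L (E 1 1) (E 1 1) + bil L (E 0 2) (E 0 2)) ≤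
      bil L (X 0 0) (X 0 0) := by
  have e00 := hE 0 0 (by norm_num)
  have e10 := hE 1 0 (by norm_num)
  have e01 := hE 0 1 (by norm_num)
  have e11 := hE 1 1 (by norm_num)
  have e02 := hE 0 2 (by norm_num)
  simp only [zero_add, Nat.reduceAdd] at e00 e10 e01 e11 e02
  have s := bil_helmholtz hE hXE (hX 0 0 le_rfl).memLp
  have s0 := bil_helmholtz hE hXE e00.memLp
  have s1 := bil_helmholtz hE hXE e10.memLp_x
  have s2 := bil_helmholtz hE hXE e01.memLp_y
  have h1 := e10.bil_x hL e00
  have h2 := e01.bil_y hL e00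
  have h3 := e10.bil_x hL e02
  have h4 := e10.bil_y hL e11
  rw [bil_comm L (E 0 0) (X 0 0), bil_comm L (E 2 0) (X 0 0), bil_comm L (E 0 2) (X 0 0)] at s
  rw [bil_comm L (E 0 0) (E 2 0), bil_comm L (E 0 2) (E 2 0)] at s1
  rw [bil_comm L (E 0 0) (E 0 2)] at s2
  linarith [bil_self_nonneg L (E 0 0), bil_self_nonneg L (E 1 0), bil_self_nonneg L (E 0 1)]

/-- `‖ξ‖²` vanishes together with the `H¹` norm of `η`. -/
theorem bil_self_eq (hL : 0 < L) (hE : IsPerJet L 3 E) (hX : IsPerJet L 1 X)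
    (hXE : X 0 0 =ᵐ[volume.restrict (square L)] fun p => E 0 0 p - (E 2 0 p + E 0 2 p)) :
    bil L (X 0 0) (X 0 0) =
      bil L (E 0 0) (X 0 0) + bil L (E 1 0) (X 1 0) + bil L (E 0 1) (X 0 1) := by
  have x00 := hX 0 0 le_rfl
  have s := bil_helmholtz hE hXE x00.memLp
  have h1 := (hE 1 0 (by norm_num)).bil_x hL x00
  have h2 := (hE 0 1 (by norm_num)).bil_y hL x00
  simp only [zero_add, Nat.reduceAdd] at h1 h2
  linarith

/-- Pointwise |bc| ≤ max(|b|, |c|)² ≤ b² + c², so the off-diagonal terms of the form reduce to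
integrals of type ∫ |f| g². -/
theorem enorm_tri_le (L : ℝ) {a b c : ℝ × ℝ → ℝ}
    (ha : AEStronglyMeasurable a (volume.restrict (square L)))
    (hb : AEStronglyMeasurable b (volume.restrict (square L))) :
    ‖tri L a b c‖ₑ ≤ (∫⁻ p in square L, ‖a p‖ₑ * ‖b p‖ₑ ^ 2) +
      ∫⁻ p in square L, ‖a p‖ₑ * ‖c p‖ₑ ^ 2 := by
  refine (enorm_integral_le_lintegral_enorm _).trans ?_
  have hm : AEMeasurable (fun p => ‖a p‖ₑ * ‖b p‖ₑ ^ 2) (volume.restrict (square L)) :=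
    ha.enorm.mul (hb.enorm.pow_const _)
  rw [← lintegral_add_left' hm]
  refine lintegral_mono fun p => ?_
  rw [enorm_mul, enorm_mul, ← mul_add]
  gcongr
  rcases le_total ‖b p‖ₑ ‖c p‖ₑ with h | h
  · exact (mul_le_mul_left h _).trans ((sq _).symm.le.trans le_add_self)
  · exact (mul_le_mul_right h _).trans ((sq _).symm.le.trans le_self_add)

theorem enorm_tri_self_le (L : ℝ) (a b : ℝ × ℝ → ℝ) :
    ‖tri L a b b‖ₑ ≤ ∫⁻ p in square L, ‖a p‖ₑ * ‖b p‖ₑ ^ 2 := by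
  refine (enorm_integral_le_lintegral_enorm _).trans (lintegral_mono fun p => ?_)
  rw [enorm_mul, enorm_mul, sq]

/-- The estimate of the quadratic form in `∇η` by the energy, up to an exponentially small
error. -/
theorem abs_form_le (hL : 0 < L) (hE : IsPerJet L 3 E) (hU : IsPerJet L 3 U)
    (hX : IsPerJet L 1 X)
    (hXE : X 0 0 =ᵐ[volume.restrict (square L)] fun p => E 0 0 p - (E 2 0 p + E 0 2 p))
    {K : ℝ} (hK : 0 < K)
    (hUK : ∀ a b, a + b = 2 → sobConst L * h1Sq L (U a b) (U (a + 1) b) (U a (b + 1)) ≤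
      ENNReal.ofReal K ^ 2) (m : ℕ) :
    |tri L (U 1 1) (E 1 0) (E 1 0) - tri L (U 1 1) (E 0 1) (E 0 1) +
        (tri L (U 0 2) (E 1 0) (E 0 1) - tri L (U 2 0) (E 1 0) (E 0 1))| ≤
      12 * (m + 1) * K * (bil L (E 0 0) (X 0 0) +
        (4 ^ (m + 1))⁻¹ * ((logConst L).toReal * bil L (X 0 0) (X 0 0))) := by
  have e10 := hE 1 0 (by norm_num)
  have e01 := hE 0 1 (by norm_num)
  have u11 := hU 1 1 (by norm_num)
  have u02 := hU 0 2 (by norm_num)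
  have u20 := hU 2 0 (by norm_num)
  simp only [zero_add, Nat.reduceAdd] at e10 e01 u11 u02 u20
  set k := ENNReal.ofReal K
  have k0 : k ≠ 0 := (ENNReal.ofReal_pos.2 hK).ne'
  have kt : k ≠ ∞ := ENNReal.ofReal_ne_top
  set R : (ℝ × ℝ → ℝ) → ℝ≥0∞ → ℝ≥0∞ := fun g N => 4 * (m + 1) * k *
    ((∫⁻ p in square L, ‖g p‖ₑ ^ 2) + (4 ^ (m + 1))⁻¹ * (logConst L * N)) with hR
  set R₁ := R (E 1 0) (h1Sq L (E 1 0) (E 2 0) (E 1 1))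
  set R₂ := R (E 0 1) (h1Sq L (E 0 1) (E 1 1) (E 0 2))
  have est1 : ∀ f fx fy, PerH1 L f fx fy → sobConst L * h1Sq L f fx fy ≤ k ^ 2 →
      ∫⁻ p in square L, ‖f p‖ₑ * ‖E 1 0 p‖ₑ ^ 2 ≤ R₁ :=
    fun f fx fy hf hk => lintegral_mul_sq_le hL hf e10 k0 kt hk m
  have est2 : ∀ f fx fy, PerH1 L f fx fy → sobConst L * h1Sq L f fx fy ≤ k ^ 2 →
      ∫⁻ p in square L, ‖f p‖ₑ * ‖E 0 1 p‖ₑ ^ 2 ≤ R₂ :=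
    fun f fx fy hf hk => lintegral_mul_sq_le hL hf e01 k0 kt hk m
  have k11 := hUK 1 1 rfl
  have k02 := hUK 0 2 rfl
  have k20 := hUK 2 0 rfl
  simp only [zero_add, Nat.reduceAdd] at k11 k02 k20
  have t1 : ‖tri L (U 1 1) (E 1 0) (E 1 0)‖ₑ ≤ R₁ :=
    (enorm_tri_self_le L _ _).trans (est1 _ _ _ u11 k11)
  have t2 : ‖tri L (U 1 1) (E 0 1) (E 0 1)‖ₑ ≤ R₂ :=
    (enorm_tri_self_le L _ _).trans (est2 _ _ _ u11 k11)
  have t3 : ‖tri L (U 0 2) (E 1 0) (E 0 1)‖ₑ ≤ R₁ + R₂ :=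
    (enorm_tri_le L u02.memLp.1 e10.memLp.1).trans
      (add_le_add (est1 _ _ _ u02 k02) (est2 _ _ _ u02 k02))
  have t4 : ‖tri L (U 2 0) (E 1 0) (E 0 1)‖ₑ ≤ R₁ + R₂ :=
    (enorm_tri_le L u20.memLp.1 e10.memLp.1).trans
      (add_le_add (est1 _ _ _ u20 k20) (est2 _ _ _ u20 k20))
  set b₁ := bil L (E 1 0) (E 1 0)
  set b₂ := bil L (E 0 1) (E 0 1)
  set ε := bil L (E 0 0) (X 0 0) with hε
  set z := bil L (X 0 0) (X 0 0)
  set C := (logConst L).toReal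
  have hCt : logConst L ≠ ∞ := by
    have hV : volume (square L) ≠ ∞ := by
      have := measure_ne_top (volume.restrict (square L)) Set.univ
      simpa using this
    have hC : sobConst L ≠ ∞ := by simp [sobConst, ENNReal.mul_eq_top]
    exact ENNReal.mul_ne_top (ENNReal.mul_ne_top (by norm_num) hV) hC
  have hb : b₁ + b₂ ≤ ε := by
    rw [hε, bil_helmholtz_self hL hE hXE]
    linarith [bil_self_nonneg L (E 0 0)]
  have hz := bil_second_le hL hE hX hXE
  have hz0 : 0 ≤ z := bil_self_nonneg L _
  have hb1 : 0 ≤ b₁ := bil_self_nonneg L _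
  have hb2 : 0 ≤ b₂ := bil_self_nonneg L _
  have hε0 : 0 ≤ ε := by linarith
  have hRR : R₁ + R₂ ≤ ENNReal.ofReal (4 * (m + 1) * K * (ε + (4 ^ (m + 1))⁻¹ * (C * z))) := by
    have hsum : h1Sq L (E 1 0) (E 2 0) (E 1 1) + h1Sq L (E 0 1) (E 1 1) (E 0 2) ≤
        ENNReal.ofReal z := by
      rw [e10.h1Sq_eq, e01.h1Sq_eq, ← ENNReal.ofReal_add]
      · exact ENNReal.ofReal_le_ofReal hz
      · linarith [bil_self_nonneg L (E 2 0), bil_self_nonneg L (E 1 1)]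
      · linarith [bil_self_nonneg L (E 0 2), bil_self_nonneg L (E 1 1)]
    calc R₁ + R₂ = 4 * (m + 1) * k * ((ENNReal.ofReal b₁ + ENNReal.ofReal b₂) +
          (4 ^ (m + 1))⁻¹ * (logConst L * (h1Sq L (E 1 0) (E 2 0) (E 1 1) +
            h1Sq L (E 0 1) (E 1 1) (E 0 2)))) := by
          simp only [R₁, R₂, hR]
          rw [lintegral_enorm_sq e10.memLp, lintegral_enorm_sq e01.memLp]
          ring
      _ ≤ 4 * (m + 1) * k * (ENNReal.ofReal ε +
          (4 ^ (m + 1))⁻¹ * (logConst L * ENNReal.ofReal z)) := by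
          rw [← ENNReal.ofReal_add hb1 hb2]
          gcongr
      _ = _ := by
          have h4 : ((4 : ℝ≥0∞) ^ (m + 1))⁻¹ = ENNReal.ofReal ((4 ^ (m + 1))⁻¹) := by
            rw [ENNReal.ofReal_inv_of_pos (by positivity), ENNReal.ofReal_pow (by norm_num)]
            norm_num
          have hm : (4 : ℝ≥0∞) * (m + 1) = ENNReal.ofReal (4 * (m + 1)) := by
            rw [ENNReal.ofReal_mul (by norm_num), ENNReal.ofReal_add (by positivity) (by norm_num)]
            simp
          have hC : 0 ≤ C := ENNReal.toReal_nonneg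
          rw [h4, hm, ENNReal.ofReal_mul (p := 4 * (m + 1) * K) (by positivity),
            ENNReal.ofReal_mul (p := 4 * ((m : ℝ) + 1)) (by positivity),
            ENNReal.ofReal_add hε0 (by positivity), ENNReal.ofReal_mul (p := (4 ^ (m + 1))⁻¹)
              (by positivity), ENNReal.ofReal_mul hC, ENNReal.ofReal_toReal hCt]
  have hpos : 0 ≤ 4 * (m + 1) * K * (ε + (4 ^ (m + 1))⁻¹ * (C * z)) := by
    have : 0 ≤ C := ENNReal.toReal_nonneg
    positivity
  have conv : ∀ {x : ℝ}, ‖x‖ₑ ≤ R₁ + R₂ →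
      |x| ≤ 4 * (m + 1) * K * (ε + (4 ^ (m + 1))⁻¹ * (C * z)) := by
    intro x hx
    rw [← Real.norm_eq_abs, ← ENNReal.ofReal_le_ofReal_iff hpos, ofReal_norm]
    exact hx.trans hRR
  -- The two diagonal terms together use R₁ + R₂ once, and each off-diagonal term uses it once more:
  -- 3 · 4 = 12.
  have t12 : |tri L (U 1 1) (E 1 0) (E 1 0) - tri L (U 1 1) (E 0 1) (E 0 1)| ≤
      4 * (m + 1) * K * (ε + (4 ^ (m + 1))⁻¹ * (C * z)) :=
    conv (enorm_sub_le.trans (add_le_add t1 t2))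
  have t3' := conv t3
  have t4' := conv t4
  rw [abs_le] at *
  constructor <;> linarith

/-- The rate of change of the energy of the difference of two solutions. -/
theorem abs_energy_rate_le (hL : 0 < L) (hE : IsPerJet L 3 E) (hU : IsPerJet L 3 U)
    (hX : IsPerJet L 1 X) (hW : IsPerJet L 1 W)
    (hXE : X 0 0 =ᵐ[volume.restrict (square L)] fun p => E 0 0 p - (E 2 0 p + E 0 2 p))
    {N : ℝ × ℝ → ℝ} {κ : ℝ}
    (hN : ∀ᵐ p ∂(volume.restrict (square L)), N p = κ * E 0 1 p -
      (U 1 0 p * X 0 1 p - U 0 1 p * X 1 0 p) - (E 1 0 p * W 0 1 p - E 0 1 p * W 1 0 p))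
    {K : ℝ} (hK : 0 < K)
    (hUK : ∀ a b, a + b = 2 → sobConst L * h1Sq L (U a b) (U (a + 1) b) (U a (b + 1)) ≤
      ENNReal.ofReal K ^ 2) (m : ℕ) :
    |bil L (E 0 0) N| ≤
      12 * (m + 1) * K * (bil L (E 0 0) (X 0 0) +
        (4 ^ (m + 1))⁻¹ * ((logConst L).toReal * bil L (X 0 0) (X 0 0))) := by
  have e00 := hE 0 0 (by norm_num)
  have e10 := hE 1 0 (by norm_num)
  have e01 := hE 0 1 (by norm_num)
  have u10 := hU 1 0 (by norm_num)
  have u01 := hU 0 1 (by norm_num)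
  have x00 := hX 0 0 le_rfl
  have w00 := hW 0 0 le_rfl
  simp only [zero_add, Nat.reduceAdd] at e00 e10 e01 u10 u01 x00 w00
  have e4 := e00.memLp_four hL
  have i0 := (integrable_mul_of_memLp_two e01.memLp e00.memLp).const_mul κ
  have i1 := integrable_mul_mul x00.memLp_y e4 (u10.memLp_four hL)
  have i2 := integrable_mul_mul x00.memLp_x e4 (u01.memLp_four hL)
  have i3 := integrable_mul_mul w00.memLp_y e4 (e10.memLp_four hL)
  have i4 := integrable_mul_mul w00.memLp_x e4 (e01.memLp_four hL)
  have hbil : bil L (E 0 0) N = κ * bil L (E 0 1) (E 0 0) -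
      (tri L (X 0 1) (E 0 0) (U 1 0) - tri L (X 1 0) (E 0 0) (U 0 1)) -
      (tri L (W 0 1) (E 0 0) (E 1 0) - tri L (W 1 0) (E 0 0) (E 0 1)) := by
    simp only [bil, tri]
    rw [← integral_const_mul, ← integral_sub i1 i2, ← integral_sub i3 i4]
    have j1 := i1.sub i2
    have j2 := i3.sub i4
    have e1 := integral_sub i0 j1
    have e2 := integral_sub (i0.sub j1) j2
    simp only [Pi.sub_apply] at e1 e2
    rw [← e1, ← e2]
    refine integral_congr_ae (hN.mono fun p hp => ?_)
    simp only [hp]; ring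
  have hself := e00.bil_y hL e00
  rw [bil_comm L (E 0 0) (E 0 1)] at hself
  rw [hbil, tri_bracket_self hL hE hW, tri_bracket_eq hL hE hU hX hXE,
    show bil L (E 0 1) (E 0 0) = 0 by linarith, mul_zero, sub_zero, zero_sub, abs_neg]
  exact abs_form_le hL hE hU hX hXE hK hUK m

end energy

/-! ### Weak time derivatives -/

section WeakDeriv

/-- A smooth monotone step from `0` to `1` on `[s, s + 1 / c]`. -/
def smoothStep (c s r : ℝ) : ℝ := Real.smoothTransition (c * (r - s))

theorem contDiff_smoothStep (c s : ℝ) : ContDiff ℝ (⊤ : ℕ∞) (smoothStep c s) :=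
  Real.smoothTransition.contDiff.comp (by fun_prop)

theorem smoothStep_of_le {c s r : ℝ} (hc : 0 < c) (hr : r ≤ s) : smoothStep c s r = 0 :=
  Real.smoothTransition.zero_of_nonpos (mul_nonpos_of_nonneg_of_nonpos hc.le (by linarith))

theorem smoothStep_of_ge {c s r : ℝ} (hc : 0 < c) (hr : s + 1 / c ≤ r) : smoothStep c s r = 1 := by
  refine Real.smoothTransition.one_of_one_le ?_
  have : 1 / c ≤ r - s := by linarith
  rw [div_le_iff₀ hc] at this
  linarith

theorem deriv_smoothStep_nonneg {c : ℝ} (hc : 0 < c) (s r : ℝ) : 0 ≤ deriv (smoothStep c s) r := by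
  refine Monotone.deriv_nonneg fun x y hxy => Real.smoothTransition.monotone ?_
  gcongr

theorem deriv_smoothStep_eq_zero {c s r : ℝ} (hc : 0 < c) (hr : r ∉ Set.Icc s (s + 1 / c)) :
    deriv (smoothStep c s) r = 0 := by
  have : r < s ∨ s + 1 / c < r := by
    by_contra! h
    exact hr ⟨h.1, h.2⟩
  rcases this with h | h
  · have : smoothStep c s =ᶠ[𝓝 r] fun _ => 0 :=
      (eventually_lt_nhds h).mono fun x hx => smoothStep_of_le hc hx.le
    rw [this.deriv_eq, deriv_const]
  · have : smoothStep c s =ᶠ[𝓝 r] fun _ => 1 :=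
      (eventually_gt_nhds h).mono fun x hx => smoothStep_of_ge hc hx.le
    rw [this.deriv_eq, deriv_const]

theorem continuous_deriv_smoothStep (c s : ℝ) : Continuous (deriv (smoothStep c s)) :=
  (contDiff_smoothStep c s).continuous_deriv (by exact_mod_cast le_top)

theorem setIntegral_deriv_smoothStep {c s T : ℝ} (hc : 0 < c) (hs : s ∈ Set.Ioo 0 T)
    (hsT : s + 1 / c ≤ T) : ∫ r in Set.Ioo 0 T, deriv (smoothStep c s) r = 1 := by
  have hT : 0 ≤ T := (hs.1.trans hs.2).le
  rw [← integral_Ioc_eq_integral_Ioo, ← intervalIntegral.integral_of_le hT,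
    intervalIntegral.integral_deriv_eq_sub, smoothStep_of_ge hc hsT, smoothStep_of_le hc hs.1.le,
    sub_zero]
  · intro x _
    exact ((contDiff_smoothStep c s).differentiable (by simp)).differentiableAt
  · exact (continuous_deriv_smoothStep c s).intervalIntegrable _ _

variable {F : Type*} [NormedAddCommGroup F] [NormedSpace ℝ F]

theorem integrableOn_smul_of_continuousOn {T : ℝ} {g : ℝ → ℝ} (hg : Continuous g) {u : ℝ → F}
    (hu : ContinuousOn u (Set.Icc 0 T)) : IntegrableOn (fun r => g r • u r) (Set.Ioo 0 T) :=
  ((hg.continuousOn.smul hu).integrableOn_compact isCompact_Icc).mono_set Set.Ioo_subset_Icc_self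

/-- The derivatives are nonnegative with mass one on [s, s + 1/(n+1)]: an approximate identity at s
from the right. -/
theorem tendsto_integral_deriv_smoothStep [CompleteSpace F] {T s : ℝ} (hs : s ∈ Set.Ioo 0 T) {u : ℝ → F}
    (hu : ContinuousOn u (Set.Icc 0 T)) :
    Tendsto (fun n : ℕ => ∫ r in Set.Ioo 0 T, deriv (smoothStep (n + 1) s) r • u r) atTop
      (𝓝 (u s)) := by
  have huc : ContinuousAt u s := hu.continuousAt (Icc_mem_nhds hs.1 hs.2)
  rw [Metric.tendsto_atTop']
  intro ε hε
  obtain ⟨δ, hδ, hδu⟩ := Metric.continuousAt_iff.1 huc (ε / 2) (by positivity)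
  obtain ⟨n₀, hn₀⟩ := exists_nat_one_div_lt (lt_min hδ (sub_pos.2 hs.2))
  refine ⟨n₀, fun n hn => ?_⟩
  have hc : (0 : ℝ) < n + 1 := by positivity
  have hn1 : 1 / ((n : ℝ) + 1) < min δ (T - s) := by
    refine lt_of_le_of_lt ?_ hn₀
    have : (n₀ : ℝ) ≤ n := by exact_mod_cast hn.le
    gcongr
  have hsT : s + 1 / ((n : ℝ) + 1) ≤ T := by
    have := hn1.trans_le (min_le_right _ _); linarith
  have h1 := setIntegral_deriv_smoothStep hc hs hsT
  have hd := continuous_deriv_smoothStep ((n : ℝ) + 1) s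
  have i1 := integrableOn_smul_of_continuousOn hd hu
  have i2 := integrableOn_smul_of_continuousOn (T := T) hd
    (continuousOn_const (c := u s))
  have i3 : IntegrableOn (deriv (smoothStep (n + 1) s)) (Set.Ioo 0 T) :=
    (hd.continuousOn.integrableOn_compact isCompact_Icc).mono_set Set.Ioo_subset_Icc_self
  have hus : u s = ∫ r in Set.Ioo 0 T, deriv (smoothStep (n + 1) s) r • u s := by
    rw [integral_smul_const, h1, one_smul]
  rw [dist_eq_norm]
  nth_rw 1 [hus]
  rw [← integral_sub i1 i2]
  have hbound : ∀ r, ‖deriv (smoothStep (n + 1) s) r • u r -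
      deriv (smoothStep (n + 1) s) r • u s‖ ≤ deriv (smoothStep (n + 1) s) r * (ε / 2) := by
    intro r
    rw [← smul_sub, norm_smul, Real.norm_of_nonneg (deriv_smoothStep_nonneg hc s r)]
    by_cases hr : r ∈ Set.Icc s (s + 1 / ((n : ℝ) + 1))
    · refine mul_le_mul_of_nonneg_left ?_ (deriv_smoothStep_nonneg hc s r)
      rw [← dist_eq_norm]
      refine (hδu ?_).le
      rw [Real.dist_eq, abs_lt]
      have := hn1.trans_le (min_le_left _ _)
      constructor <;> linarith [hr.1, hr.2]
    · rw [deriv_smoothStep_eq_zero hc hr]; simp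
  refine (norm_integral_le_of_norm_le (i3.mul_const (ε / 2))
    (Eventually.of_forall hbound)).trans_lt ?_
  rw [integral_mul_const, h1]
  linarith

theorem tendsto_smoothStep {s r : ℝ} (hr : s < r) :
    Tendsto (fun n : ℕ => smoothStep (n + 1) s r) atTop (𝓝 1) := by
  obtain ⟨n₀, hn₀⟩ := exists_nat_one_div_lt (sub_pos.2 hr)
  refine tendsto_const_nhds.congr' ?_
  filter_upwards [eventually_ge_atTop n₀] with n hn
  refine (smoothStep_of_ge (by positivity) ?_).symm
  have : (n₀ : ℝ) ≤ n := by exact_mod_cast hn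
  have : 1 / ((n : ℝ) + 1) ≤ 1 / ((n₀ : ℝ) + 1) := by gcongr
  linarith

/-- The difference of two steps tends pointwise to the indicator of (s, t] and is bounded by 1, so
dominated convergence applies. -/
theorem tendsto_integral_smoothStep_sub {T s t : ℝ} (hs : 0 ≤ s) (hst : s ≤ t) (ht : t ≤ T)
    {v : ℝ → F} (hv : IntegrableOn v (Set.Ioo 0 T)) :
    Tendsto (fun n : ℕ => ∫ r in Set.Ioo 0 T,
      (smoothStep (n + 1) s r - smoothStep (n + 1) t r) • v r) atTop (𝓝 (∫ r in s..t, v r)) := by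
  have hlim : ∫ r in s..t, v r = ∫ r in Set.Ioo 0 T, (Set.Ioc s t).indicator v r := by
    rw [intervalIntegral.integral_of_le hst, ← integral_Ioc_eq_integral_Ioo,
      setIntegral_indicator measurableSet_Ioc]
    congr 2
    exact (Set.inter_eq_right.2 (Set.Ioc_subset_Ioc hs ht)).symm
  rw [hlim]
  refine tendsto_integral_of_dominated_convergence (fun r => ‖v r‖) (fun n => ?_) hv.norm
    (fun n => Eventually.of_forall fun r => ?_) (Eventually.of_forall fun r => ?_)
  · exact (((contDiff_smoothStep _ s).continuous.sub
      (contDiff_smoothStep _ t).continuous).aestronglyMeasurable).smul hv.1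
  · rw [norm_smul]
    refine mul_le_of_le_one_left (norm_nonneg _) ?_
    rw [Real.norm_eq_abs, abs_le]
    have h1 := Real.smoothTransition.nonneg (((n : ℝ) + 1) * (r - s))
    have h2 := Real.smoothTransition.le_one (((n : ℝ) + 1) * (r - s))
    have h3 := Real.smoothTransition.nonneg (((n : ℝ) + 1) * (r - t))
    have h4 := Real.smoothTransition.le_one (((n : ℝ) + 1) * (r - t))
    simp only [smoothStep]
    constructor <;> linarith
  · have hz : ∀ {x : ℝ}, r ≤ x → Tendsto (fun n : ℕ => smoothStep (n + 1) x r) atTop (𝓝 0) := by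
      intro x hx
      refine tendsto_const_nhds.congr fun n => (smoothStep_of_le (by positivity) hx).symm
    by_cases h1 : r ≤ s
    · rw [Set.indicator_of_notMem (fun h : r ∈ Set.Ioc s t => absurd h.1 (not_lt.2 h1))]
      simpa using ((hz h1).sub (hz (h1.trans hst))).smul_const (v r)
    · push Not at h1
      by_cases h2 : r ≤ t
      · rw [Set.indicator_of_mem (show r ∈ Set.Ioc s t from ⟨h1, h2⟩)]
        simpa using ((tendsto_smoothStep h1).sub (hz h2)).smul_const (v r)
      · push Not at h2
        rw [Set.indicator_of_notMem (fun h : r ∈ Set.Ioc s t => absurd h.2 (not_le.2 h2))]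
        simpa using ((tendsto_smoothStep h1).sub (tendsto_smoothStep h2)).smul_const (v r)

/-- A continuous function is the primitive of its weak derivative. -/
theorem sub_eq_integral_of_weakDeriv [CompleteSpace F] {T : ℝ} {u v : ℝ → F}
    (hu : ContinuousOn u (Set.Icc 0 T)) (hv : IntegrableOn v (Set.Ioo 0 T))
    (h : ∀ ψ : ℝ → ℝ, ContDiff ℝ (⊤ : ℕ∞) ψ → HasCompactSupport ψ → tsupport ψ ⊆ Set.Ioo 0 T →
      ∫ t in Set.Ioo 0 T, deriv ψ t • u t = - ∫ t in Set.Ioo 0 T, ψ t • v t)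
    {s t : ℝ} (hs : 0 ≤ s) (hst : s ≤ t) (ht : t ≤ T) : u t - u s = ∫ r in s..t, v r := by
  -- The test function is the difference of steps at s and t. Its support lies in [s, t + 1/(n+1)],
  -- so s and t must first be interior.
  have hopen : ∀ s t, 0 < s → s ≤ t → t < T → u t - u s = ∫ r in s..t, v r := by
    intro s t hs hst ht
    have hsI : s ∈ Set.Ioo 0 T := ⟨hs, hst.trans_lt ht⟩
    have htI : t ∈ Set.Ioo 0 T := ⟨hs.trans_le hst, ht⟩
    have l1 := (tendsto_integral_deriv_smoothStep hsI hu).sub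
      (tendsto_integral_deriv_smoothStep htI hu)
    have l2 := (tendsto_integral_smoothStep_sub hs.le hst ht.le hv).neg
    have : u s - u t = - ∫ r in s..t, v r := by
      refine tendsto_nhds_unique (l1.congr' ?_) l2
      obtain ⟨n₀, hn₀⟩ := exists_nat_one_div_lt (sub_pos.2 ht)
      filter_upwards [eventually_ge_atTop n₀] with n hn
      have hc : (0 : ℝ) < n + 1 := by positivity
      have hn1 : 1 / ((n : ℝ) + 1) < T - t := by
        refine lt_of_le_of_lt ?_ hn₀
        have : (n₀ : ℝ) ≤ n := by exact_mod_cast hn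
        gcongr
      have hzero : ∀ r, r ∉ Set.Icc s (t + 1 / ((n : ℝ) + 1)) →
          smoothStep (n + 1) s r - smoothStep (n + 1) t r = 0 := by
        intro r hr
        have : r < s ∨ t + 1 / ((n : ℝ) + 1) < r := by
          by_contra! h
          exact hr ⟨h.1, h.2⟩
        rcases this with h | h
        · rw [smoothStep_of_le hc h.le, smoothStep_of_le hc (h.le.trans hst), sub_zero]
        · rw [smoothStep_of_ge hc h.le, smoothStep_of_ge hc (by linarith), sub_self]
      have hd : ∀ r, deriv (fun r => smoothStep (n + 1) s r - smoothStep (n + 1) t r) r =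
          deriv (smoothStep (n + 1) s) r - deriv (smoothStep (n + 1) t) r := fun r =>
        deriv_fun_sub ((contDiff_smoothStep _ s).differentiable (by simp)).differentiableAt
          ((contDiff_smoothStep _ t).differentiable (by simp)).differentiableAt
      have hw := h (fun r => smoothStep (n + 1) s r - smoothStep (n + 1) t r)
        ((contDiff_smoothStep _ s).sub (contDiff_smoothStep _ t))
        (HasCompactSupport.intro isCompact_Icc fun r hr => hzero r hr)
        ((closure_minimal (show Function.support _ ⊆ Set.Icc s (t + 1 / ((n : ℝ) + 1)) from
          fun r hr => by_contra fun hr' => hr (hzero r hr')) isClosed_Icc).trans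
          (Set.Icc_subset_Ioo hs (by linarith)))
      rw [← hw, ← integral_sub
        (integrableOn_smul_of_continuousOn (continuous_deriv_smoothStep _ s) hu)
        (integrableOn_smul_of_continuousOn (continuous_deriv_smoothStep _ t) hu)]
      simp only [hd, sub_smul]
    rw [← neg_sub, this, neg_neg]
  rcases hst.eq_or_lt with rfl | hst
  · simp
  have hvI : IntegrableOn v (Set.Icc 0 T) := (integrableOn_Icc_iff_integrableOn_Ioo (by simp) (by simp)).2 hv
  have hvii : ∀ a b, a ∈ Set.Icc 0 T → b ∈ Set.Icc 0 T → IntervalIntegrable v volume a b :=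
    fun a b ha hb => (hvI.mono_set (Set.uIcc_subset_Icc ha hb)).intervalIntegrable
  have hT : 0 ≤ T := hs.trans (hst.le.trans ht)
  -- By `hopen` this function is constant on the open interval; its continuity carries the identity
  -- to the endpoints.
  have hP : ContinuousOn (fun x => u x - ∫ r in (0 : ℝ)..x, v r) (Set.Icc 0 T) := by
    have := intervalIntegral.continuousOn_primitive_interval (f := v) (μ := volume) (a := 0)
      (b := T) (by rwa [Set.uIcc_of_le hT])
    rw [Set.uIcc_of_le hT] at this
    exact hu.sub this
  have hconst : ∀ x ∈ Set.Ioo 0 T, u x - ∫ r in (0 : ℝ)..x, v r =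
      u (T / 2) - ∫ r in (0 : ℝ)..(T / 2), v r := by
    have hle : ∀ x y, 0 < x → x ≤ y → y < T → u x - (∫ r in (0 : ℝ)..x, v r) =
        u y - ∫ r in (0 : ℝ)..y, v r := by
      intro x y hx hxy hy
      have h1 := hopen x y hx hxy hy
      have h2 := intervalIntegral.integral_add_adjacent_intervals
        (hvii 0 x ⟨le_rfl, hT⟩ ⟨hx.le, (hxy.trans_lt hy).le⟩)
        (hvii x y ⟨hx.le, (hxy.trans_lt hy).le⟩ ⟨(hx.trans_le hxy).le, hy.le⟩)
      rw [← h2, ← h1]; abel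
    intro x hx
    have hT' : 0 < T := hx.1.trans hx.2
    rcases le_total x (T / 2) with h | h
    · exact hle _ _ hx.1 h (by linarith)
    · exact (hle _ _ (by linarith) h hx.2).symm
  have hT' : 0 < T := hs.trans_lt (hst.trans_le ht)
  have hall : ∀ x ∈ Set.Icc 0 T, u x - ∫ r in (0 : ℝ)..x, v r =
      u (T / 2) - ∫ r in (0 : ℝ)..(T / 2), v r := by
    have hcl : closure (Set.Ioo 0 T) = Set.Icc 0 T := closure_Ioo hT'.ne
    have := Set.EqOn.of_subset_closure (s := Set.Ioo 0 T) (t := Set.Icc 0 T) hconst hP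
      continuousOn_const Set.Ioo_subset_Icc_self hcl.ge
    exact this
  have hsI : s ∈ Set.Icc 0 T := ⟨hs, hst.le.trans ht⟩
  have htI : t ∈ Set.Icc 0 T := ⟨hs.trans hst.le, ht⟩
  have h2 := intervalIntegral.integral_add_adjacent_intervals
    (hvii 0 s ⟨le_rfl, hT⟩ hsI) (hvii s t hsI htI)
  have h3 := (hall s hsI).trans (hall t htI).symm
  rw [← h2] at h3
  rw [sub_eq_sub_iff_add_eq_add] at h3
  rw [sub_eq_iff_eq_add]
  have h4 : u s + (∫ r in s..t, v r) + (∫ r in (0 : ℝ)..s, v r) =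
      u t + (∫ r in (0 : ℝ)..s, v r) := by rw [← h3]; abel
  rw [← add_right_cancel h4]; abel

end WeakDeriv

/-! ### Grönwall's inequality with integrable coefficients -/

/-- A transitive relation that holds on short intervals holds on all intervals. -/
theorem of_short_steps {Q : ℝ → ℝ → Prop} {a b δ : ℝ} (hδ : 0 < δ)
    (trans : ∀ r s t, a ≤ r → r ≤ s → s ≤ t → t ≤ b → Q r s → Q s t → Q r t)
    (short : ∀ s t, a ≤ s → s ≤ t → t ≤ b → t - s < δ → Q s t) :
    ∀ s t, a ≤ s → s ≤ t → t ≤ b → Q s t := by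
  -- Steps of length δ / 2 satisfy the strict bound required by `short`; the induction peels off the
  -- last one.
  have key : ∀ n : ℕ, ∀ s t, a ≤ s → s ≤ t → t ≤ b → t - s ≤ n * (δ / 2) → Q s t := by
    intro n
    induction n with
    | zero =>
      intro s t hs hst ht h
      exact short s t hs hst ht (by simp at h; linarith)
    | succ n ih =>
      intro s t hs hst ht h
      push_cast at h
      have h1 : max s (t - δ / 2) ≤ t := max_le hst (by linarith)
      have h2 : s ≤ max s (t - δ / 2) := le_max_left _ _
      refine trans s (max s (t - δ / 2)) t hs h2 h1 ht (ih s _ hs h2 (h1.trans ht) ?_)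
        (short _ t (hs.trans h2) h1 ht ?_)
      · rcases max_choice s (t - δ / 2) with h' | h' <;> rw [h']
        · simp; positivity
        · linarith
      · have := le_max_right s (t - δ / 2); linarith
  intro s t hs hst ht
  obtain ⟨n, hn⟩ := exists_nat_ge ((t - s) / (δ / 2))
  exact key n s t hs hst ht ((div_le_iff₀ (by positivity)).1 hn)

/-- The primitive of an integrable function is uniformly continuous on the compact interval. -/
theorem exists_short_integral {T : ℝ} (hT : 0 ≤ T) {k : ℝ → ℝ}
    (hk : IntervalIntegrable k volume 0 T) {ε : ℝ} (hε : 0 < ε) :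
    ∃ δ > 0, ∀ s t, 0 ≤ s → s ≤ t → t ≤ T → t - s < δ → ∫ r in s..t, k r ≤ ε := by
  have hc := intervalIntegral.continuousOn_primitive_interval' hk Set.left_mem_uIcc
  rw [Set.uIcc_of_le hT] at hc
  obtain ⟨δ, hδ, h⟩ := Metric.uniformContinuousOn_iff.1
    (isCompact_Icc.uniformContinuousOn_of_continuous hc) ε hε
  refine ⟨δ, hδ, fun s t hs hst ht hlt => ?_⟩
  have hsI : s ∈ Set.Icc 0 T := ⟨hs, hst.trans ht⟩
  have htI : t ∈ Set.Icc 0 T := ⟨hs.trans hst, ht⟩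
  have h1 := h t htI s hsI (by rw [Real.dist_eq, abs_of_nonneg (by linarith)]; exact hlt)
  rw [Real.dist_eq, intervalIntegral.integral_interval_sub_left] at h1
  · exact (le_abs_self _).trans h1.le
  · exact hk.mono_set (by rw [Set.uIcc_of_le hT, Set.uIcc_of_le htI.1]; exact Set.Icc_subset_Icc_right ht)
  · exact hk.mono_set (by rw [Set.uIcc_of_le hT, Set.uIcc_of_le hs]; exact Set.Icc_subset_Icc_right hsI.2)

theorem intervalIntegrable_mono {T : ℝ} {F : Type*} [NormedAddCommGroup F] {k : ℝ → F}
    (hk : IntervalIntegrable k volume 0 T) {s t : ℝ} (hs : 0 ≤ s) (hst : s ≤ t) (ht : t ≤ T) :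
    IntervalIntegrable k volume s t := by
  refine hk.mono_set ?_
  rw [Set.uIcc_of_le hst, Set.uIcc_of_le (hs.trans (hst.trans ht))]
  exact Set.Icc_subset_Icc hs ht

/-- Grönwall's inequality with an integrable coefficient. -/
theorem gronwall_of_integral_le {T : ℝ} {E k : ℝ → ℝ} {d : ℝ} (hd : 0 < d)
    (hE : ContinuousOn E (Set.Icc 0 T)) (hE0 : ∀ t ∈ Set.Icc 0 T, 0 ≤ E t)
    (hk : IntervalIntegrable k volume 0 T) (hk0 : ∀ t, 0 ≤ k t)
    {a b : ℝ} (ha : 0 ≤ a) (hab : a ≤ b) (hb : b ≤ T) (hEa : E a = 0)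
    (h : ∀ t, a ≤ t → t ≤ b → E t - E a ≤ ∫ r in a..t, k r * (E r + d)) :
    E b ≤ d * Real.exp (2 * ∫ r in a..b, k r) := by
  have hT : 0 ≤ T := ha.trans (hab.trans hb)
  have hkE : IntervalIntegrable (fun r => k r * (E r + d)) volume 0 T :=
    hk.mul_continuousOn (by rw [Set.uIcc_of_le hT]; exact hE.add continuousOn_const)
  have ii : ∀ {s t}, a ≤ s → s ≤ t → t ≤ b →
      IntervalIntegrable (fun r => k r * (E r + d)) volume s t := fun hs hst ht =>
    intervalIntegrable_mono hkE (ha.trans hs) hst (ht.trans hb)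
  have ik : ∀ {s t}, a ≤ s → s ≤ t → t ≤ b → IntervalIntegrable k volume s t := fun hs hst ht =>
    intervalIntegrable_mono hk (ha.trans hs) hst (ht.trans hb)
  -- R is a nondecreasing majorant of E + d. Bounding the integrand by R t on short intervals avoids
  -- differentiating R, whose coefficient k is merely integrable.
  set R : ℝ → ℝ := fun t => d + ∫ r in a..t, k r * (E r + d) with hR
  have hER : ∀ t, a ≤ t → t ≤ b → E t + d ≤ R t := by
    intro t h1 h2
    have := h t h1 h2
    rw [hEa] at this
    simp only [hR]; linarith
  have hRsub : ∀ s t, a ≤ s → s ≤ t → t ≤ b → R t - R s = ∫ r in s..t, k r * (E r + d) := by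
    intro s t hs hst ht
    have := intervalIntegral.integral_add_adjacent_intervals (ii le_rfl hs (hst.trans ht))
      (ii hs hst ht)
    simp only [hR, ← this]; ring
  have hmono : ∀ s t, a ≤ s → s ≤ t → t ≤ b → R s ≤ R t := by
    intro s t hs hst ht
    rw [← sub_nonneg, hRsub s t hs hst ht]
    refine intervalIntegral.integral_nonneg hst fun r hr => mul_nonneg (hk0 r) ?_
    have := hE0 r ⟨ha.trans (hs.trans hr.1), hr.2.trans (ht.trans hb)⟩
    linarith
  have hRpos : ∀ s, a ≤ s → s ≤ b → 0 ≤ R s := fun s h1 h2 => by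
    have := hER s h1 h2
    have := hE0 s ⟨ha.trans h1, h2.trans hb⟩
    linarith
  obtain ⟨δ, hδ, hshort⟩ := exists_short_integral hT hk (ε := 1 / 2) (by norm_num)
  have key : ∀ s t, a ≤ s → s ≤ t → t ≤ b → R t ≤ R s * Real.exp (2 * ∫ r in s..t, k r) := by
    refine of_short_steps (Q := fun s t => R t ≤ R s * Real.exp (2 * ∫ r in s..t, k r)) hδ ?_ ?_
    · intro r s t hr hrs hst ht h1 h2
      rw [← intervalIntegral.integral_add_adjacent_intervals (ik hr hrs (hst.trans ht))
        (ik (hr.trans hrs) hst ht), mul_add, Real.exp_add, ← mul_assoc]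
      exact h2.trans (by gcongr)
    · intro s t hs hst ht hlt
      set x := ∫ r in s..t, k r with hx
      have hx0 : 0 ≤ x := intervalIntegral.integral_nonneg hst fun r _ => hk0 r
      have hx1 : x ≤ 1 / 2 := hshort s t (ha.trans hs) hst (ht.trans hb) hlt
      have h1 : R t - R s ≤ R t * x := by
        rw [hRsub s t hs hst ht, hx, mul_comm, ← intervalIntegral.integral_mul_const]
        refine intervalIntegral.integral_mono_on hst (ii hs hst ht)
          ((ik hs hst ht).mul_const _) fun r hr => ?_
        refine mul_le_mul_of_nonneg_left ?_ (hk0 r)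
        exact (hER r (hs.trans hr.1) (hr.2.trans ht)).trans
          (hmono r t (hs.trans hr.1) hr.2 ht)
      have h2 : 2 * x + 1 ≤ Real.exp (2 * x) := Real.add_one_le_exp _
      have hRt := hRpos t (hs.trans hst) ht
      have hRs := hRpos s hs (hst.trans ht)
      have h3 : R t * (1 - x) ≤ R s := by linarith
      -- This is x(1 - 2x) ≥ 0, true for 0 ≤ x ≤ 1/2. It fixes both the threshold 1/2 and the factor
      -- 2 in the exponent.
      have h4 : 1 ≤ (1 - x) * (2 * x + 1) := by nlinarith
      calc R t ≤ R t * ((1 - x) * (2 * x + 1)) := le_mul_of_one_le_right hRt h4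
        _ = (R t * (1 - x)) * (2 * x + 1) := by ring
        _ ≤ R s * Real.exp (2 * x) := by
          gcongr
  have hRa : R a = d := by simp [hR]
  have := key a b le_rfl hab le_rfl
  rw [hRa] at this
  linarith [hER b hab le_rfl]

/-- A borderline uniqueness criterion: if the growth rate `n` comes with an error `4⁻ⁿ`, for all
`n`, then the energy stays zero. -/
theorem eq_zero_of_integral_le {T : ℝ} (hT : 0 ≤ T) {E k : ℝ → ℝ} {M : ℝ} (hM : 0 < M)
    (hE : ContinuousOn E (Set.Icc 0 T)) (hE0 : ∀ t ∈ Set.Icc 0 T, 0 ≤ E t)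
    (hk : IntervalIntegrable k volume 0 T) (hk0 : ∀ t, 0 ≤ k t) (h0 : E 0 = 0)
    (h : ∀ m : ℕ, ∀ s t, 0 ≤ s → s ≤ t → t ≤ T →
      E t - E s ≤ ∫ r in s..t, ((m + 1) * k r) * (E r + (4 ^ (m + 1))⁻¹ * M)) :
    ∀ t ∈ Set.Icc 0 T, E t = 0 := by
  -- With ∫ k ≤ 1/4 the Grönwall factor is at most exp(1/2)^(m+1), which loses against 4^(m+1).
  obtain ⟨δ, hδ, hshort⟩ := exists_short_integral hT hk (ε := 1 / 4) (by norm_num)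
  -- The energy is exactly zero at the end of each short interval, so the argument restarts without
  -- loss.
  have key : ∀ s t, 0 ≤ s → s ≤ t → t ≤ T → (E s = 0 → E t = 0) := by
    refine of_short_steps (Q := fun s t => E s = 0 → E t = 0) hδ
      (fun r s t _ _ _ _ h1 h2 h => h2 (h1 h)) ?_
    intro s t hs hst ht hlt hEs
    have hA := hshort s t hs hst ht hlt
    have hbound : ∀ m : ℕ, E t ≤ M * (Real.exp (1 / 2) / 4) ^ (m + 1) := by
      intro m
      have g := gronwall_of_integral_le (T := T) (E := E) (k := fun r => (m + 1) * k r)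
        (d := (4 ^ (m + 1))⁻¹ * M) (by positivity) hE hE0 (hk.const_mul _)
        (fun r => mul_nonneg (by positivity) (hk0 r)) hs hst ht hEs
        (fun x hx1 hx2 => h m s x hs hx1 (hx2.trans ht))
      rw [intervalIntegral.integral_const_mul] at g
      refine g.trans ?_
      have : Real.exp (2 * ((m + 1) * ∫ r in s..t, k r)) ≤ Real.exp (1 / 2) ^ (m + 1) := by
        rw [← Real.exp_nat_mul]
        refine Real.exp_le_exp.2 ?_
        push_cast
        have : (0 : ℝ) ≤ m + 1 := by positivity
        nlinarith
      calc _ ≤ (4 ^ (m + 1))⁻¹ * M * Real.exp (1 / 2) ^ (m + 1) := by gcongr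
        _ = _ := by rw [div_pow]; ring
    have hlt1 : Real.exp (1 / 2) / 4 < 1 := by
      have : Real.exp (1 / 2) ≤ Real.exp 1 := Real.exp_le_exp.2 (by norm_num)
      have := Real.exp_one_lt_d9
      rw [div_lt_one (by norm_num)]
      linarith
    have hlim : Tendsto (fun m : ℕ => M * (Real.exp (1 / 2) / 4) ^ (m + 1)) atTop (𝓝 0) := by
      simpa using ((tendsto_pow_atTop_nhds_zero_of_lt_one (by positivity) hlt1).comp
        (tendsto_add_atTop_nat 1)).const_mul M
    exact le_antisymm (ge_of_tendsto' hlim hbound) (hE0 t ⟨hs.trans hst, ht⟩)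
  exact fun t ht => key 0 t le_rfl ht.1 ht.2 h0

/-! ### The energy identity -/

section energy

variable {H : Type*} [NormedAddCommGroup H] [InnerProductSpace ℝ H]

theorem intervalIntegrable_inner {T : ℝ} (hT : 0 ≤ T) {η ν : ℝ → H}
    (hη : ContinuousOn η (Set.Icc 0 T)) (hν : IntervalIntegrable ν volume 0 T) :
    IntervalIntegrable (fun r => inner ℝ (η r) (ν r)) volume 0 T := by
  rw [intervalIntegrable_iff_integrableOn_Icc_of_le hT] at hν ⊢
  obtain ⟨C, hC⟩ := isCompact_Icc.exists_bound_of_continuousOn hη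
  have hm : AEStronglyMeasurable η (volume.restrict (Set.Icc 0 T)) :=
    hη.aestronglyMeasurable measurableSet_Icc
  refine Integrable.mono' (hν.norm.const_mul C) (hm.inner hν.1) ?_
  refine (ae_restrict_mem measurableSet_Icc).mono fun r hr => ?_
  refine (norm_inner_le_norm _ _).trans ?_
  gcongr
  exact hC r hr

/-- If `η = G ξ` for a symmetric operator `G`, then `⟨η, ξ⟩` has derivative `2 ⟨η, ξ'⟩`. -/
theorem inner_sub_eq_integral [CompleteSpace H] {T : ℝ} (hT : 0 ≤ T) {η ξ ν : ℝ → H}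
    (hη : ContinuousOn η (Set.Icc 0 T)) (hν : IntervalIntegrable ν volume 0 T)
    (hξ : ∀ s t, 0 ≤ s → s ≤ t → t ≤ T → ξ t - ξ s = ∫ r in s..t, ν r)
    (hsymm : ∀ s ∈ Set.Icc 0 T, ∀ t ∈ Set.Icc 0 T, inner ℝ (η t) (ξ s) = inner ℝ (η s) (ξ t)) :
    ∀ s t, 0 ≤ s → s ≤ t → t ≤ T →
      inner ℝ (η t) (ξ t) - inner ℝ (η s) (ξ s) = ∫ r in s..t, 2 * inner ℝ (η r) (ν r) := by
  have hin := intervalIntegrable_inner hT hη hν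
  intro s t hs hst ht
  have hall : ∀ ε > 0, |inner ℝ (η t) (ξ t) - inner ℝ (η s) (ξ s) -
      ∫ r in s..t, 2 * inner ℝ (η r) (ν r)| ≤ 2 * ε * ∫ r in s..t, ‖ν r‖ := by
    intro ε hε
    obtain ⟨δ, hδ, hunif⟩ := Metric.uniformContinuousOn_iff.1
      (isCompact_Icc.uniformContinuousOn_of_continuous hη) ε hε
    refine of_short_steps (a := 0) (b := T) (Q := fun s t => |inner ℝ (η t) (ξ t) -
      inner ℝ (η s) (ξ s) - ∫ r in s..t, 2 * inner ℝ (η r) (ν r)| ≤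
        2 * ε * ∫ r in s..t, ‖ν r‖) hδ ?_ ?_ s t hs hst ht
    · intro r s t hr hrs hst ht h1 h2
      have i1 := intervalIntegrable_mono (hin.const_mul 2) hr hrs (hst.trans ht)
      have i2 := intervalIntegrable_mono (hin.const_mul 2) (hr.trans hrs) hst ht
      have j1 := intervalIntegrable_mono hν.norm hr hrs (hst.trans ht)
      have j2 := intervalIntegrable_mono hν.norm (hr.trans hrs) hst ht
      rw [← intervalIntegral.integral_add_adjacent_intervals i1 i2,
        ← intervalIntegral.integral_add_adjacent_intervals j1 j2]
      rw [abs_le] at *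
      constructor <;> linarith
    · intro s t hs hst ht hlt
      have hsI : s ∈ Set.Icc 0 T := ⟨hs, hst.trans ht⟩
      have htI : t ∈ Set.Icc 0 T := ⟨hs.trans hst, ht⟩
      have iν := intervalIntegrable_mono hν hs hst ht
      have iin := intervalIntegrable_mono hin hs hst ht
      -- Symmetry cancels the cross terms in ⟨η t + η s, ξ t - ξ s⟩. On a short interval η t + η s
      -- differs from 2 η r by at most 2ε, giving an error that is additive over subintervals.
      have hE : inner ℝ (η t) (ξ t) - inner ℝ (η s) (ξ s) =
          ∫ r in s..t, inner ℝ (η t + η s) (ν r) := by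
        have h1 := (innerSL ℝ (η t + η s)).intervalIntegral_comp_comm iν
        simp only [innerSL_apply_apply] at h1
        rw [h1, ← hξ s t hs hst ht]
        simp only [inner_add_left, inner_sub_right]
        linarith [hsymm s hsI t htI]
      have iadd : IntervalIntegrable (fun r => inner ℝ (η t + η s) (ν r)) volume s t :=
        intervalIntegrable_mono (intervalIntegrable_inner hT
          (continuousOn_const (c := η t + η s)) hν) hs hst ht
      rw [hE, ← intervalIntegral.integral_sub iadd (iin.const_mul 2),
        ← intervalIntegral.integral_const_mul, ← Real.norm_eq_abs]
      refine intervalIntegral.norm_integral_le_of_norm_le hst ?_ (iν.norm.const_mul _)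
      refine Eventually.of_forall fun r hr => ?_
      have hrI : r ∈ Set.Icc 0 T := ⟨hs.trans hr.1.le, hr.2.trans ht⟩
      have e : inner ℝ (η t + η s) (ν r) - 2 * inner ℝ (η r) (ν r) =
          inner ℝ ((η t - η r) + (η s - η r)) (ν r) := by
        simp only [inner_add_left, inner_sub_left]; ring
      rw [e]
      refine (norm_inner_le_norm _ _).trans ?_
      gcongr
      refine (norm_add_le _ _).trans ?_
      have h1 := hunif t htI r hrI (by
        rw [Real.dist_eq, abs_of_nonneg (by linarith [hr.2])]; linarith [hr.1])
      have h2 := hunif s hsI r hrI (by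
        rw [Real.dist_eq, abs_of_nonpos (by linarith [hr.1])]; linarith [hr.2])
      rw [dist_eq_norm] at h1 h2
      linarith
  have hN : 0 ≤ ∫ r in s..t, ‖ν r‖ :=
    intervalIntegral.integral_nonneg hst fun r _ => norm_nonneg _
  rw [← sub_eq_zero, ← abs_nonpos_iff]
  refine le_of_forall_pos_le_add fun ε hε => ?_
  -- The + 1 keeps the denominator positive when ν has zero integral norm.
  refine (hall (ε / (2 * ((∫ r in s..t, ‖ν r‖) + 1))) (by positivity)).trans ?_
  rw [zero_add]
  have hp : 0 < (∫ r in s..t, ‖ν r‖) + 1 := by linarith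
  rw [show 2 * (ε / (2 * ((∫ r in s..t, ‖ν r‖) + 1))) * (∫ r in s..t, ‖ν r‖) =
    ε * ((∫ r in s..t, ‖ν r‖) / ((∫ r in s..t, ‖ν r‖) + 1)) by field_simp]
  refine mul_le_of_le_one_right hε.le ?_
  rw [div_le_one hp]; linarith

end energy

/-! ### Families of derivatives -/

/-- On opposite sides the approximants have the same L² limit, so their jumps tend to 0. -/
theorem TracePeriodic.perH1 {L : ℝ} {f fx fy : L2 L} (h : TracePeriodic f fx fy) :
    PerH1 L f fx fy := by
  obtain ⟨left, right, bottom, top, ⟨φ, hs, t, tx, ty, tl, tr, tb, tt⟩, rfl, rfl⟩ := h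
  refine ⟨φ, ⟨hs, Lp.memLp f, Lp.memLp fx, Lp.memLp fy, t, tx, ty⟩, ?_, ?_⟩
  · have := tendsto_eLpNorm_sub_sub (by norm_num)
      (fun n => ((hs n).continuous.comp (by fun_prop :
        Continuous fun y : ℝ => (L, y))).aestronglyMeasurable)
      (fun n => ((hs n).continuous.comp (by fun_prop :
        Continuous fun y : ℝ => ((0 : ℝ), y))).aestronglyMeasurable)
      (Lp.aestronglyMeasurable left) (Lp.aestronglyMeasurable left) tr tl
    simpa using this
  · have := tendsto_eLpNorm_sub_sub (by norm_num)
      (fun n => ((hs n).continuous.comp (by fun_prop :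
        Continuous fun x : ℝ => (x, L))).aestronglyMeasurable)
      (fun n => ((hs n).continuous.comp (by fun_prop :
        Continuous fun x : ℝ => (x, (0 : ℝ)))).aestronglyMeasurable)
      (Lp.aestronglyMeasurable bottom) (Lp.aestronglyMeasurable bottom) tt tb
    simpa using this

/-- The derivatives of a family as functions on the plane. -/
def jetFn {L : ℝ} {m : ℕ} (J : Jet L m) (a b : ℕ) : ℝ × ℝ → ℝ :=
  if h : a + b ≤ m then (Jet.D J a b h : ℝ × ℝ → ℝ) else 0

theorem jetFn_eq {L : ℝ} {m : ℕ} (J : Jet L m) {a b : ℕ} (h : a + b ≤ m) :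
    jetFn J a b = (Jet.D J a b h : ℝ × ℝ → ℝ) := by
  simp [jetFn, h]

theorem isPerJet_jetFn {L : ℝ} {m : ℕ} {J : Jet L m} (hJ : J ∈ perSobolev L m) :
    IsPerJet L m (jetFn J) := by
  intro a b h
  rw [jetFn_eq J (a := a) (b := b) (by omega), jetFn_eq J (a := a + 1) (b := b) (by omega),
    jetFn_eq J (a := a) (b := b + 1) (by omega)]
  exact (hJ.2 a b h).perH1

theorem IsPerJet.sub {L : ℝ} {m : ℕ} {D D' : ℕ → ℕ → ℝ × ℝ → ℝ} (h : IsPerJet L m D)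
    (h' : IsPerJet L m D') : IsPerJet L m (fun a b p => D a b p - D' a b p) :=
  fun a b hab => (h a b hab).sub (h' a b hab)

theorem inner_eq_bil {L : ℝ} (f g : L2 L) : inner ℝ f g = bil L f g := by
  rw [L2.inner_def, bil]
  refine integral_congr_ae (Eventually.of_forall fun p => ?_)
  simp [mul_comm]

theorem bil_congr {L : ℝ} {a a' b b' : ℝ × ℝ → ℝ} (ha : a =ᵐ[volume.restrict (square L)] a')
    (hb : b =ᵐ[volume.restrict (square L)] b') : bil L a b = bil L a' b' :=
  integral_congr_ae (by filter_upwards [ha, hb] with p h1 h2; rw [h1, h2])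

theorem ae_eq_zero_of_bil_self {L : ℝ} {a : ℝ × ℝ → ℝ}
    (ha : MemLp a 2 (volume.restrict (square L))) (h : bil L a a = 0) :
    a =ᵐ[volume.restrict (square L)] 0 := by
  have := (integral_eq_zero_iff_of_nonneg (fun p => mul_self_nonneg (a p))
    (integrable_mul_of_memLp_two ha ha)).1 h
  exact this.mono fun p hp => mul_self_eq_zero.1 hp

theorem bil_zero_left {L : ℝ} {a b : ℝ × ℝ → ℝ} (h : a =ᵐ[volume.restrict (square L)] 0) :
    bil L a b = 0 := by
  rw [bil_congr h (EventuallyEq.refl _ b)]; simp [bil]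

/-- The solution operator of the Helmholtz equation is symmetric. -/
theorem bil_helmholtz_symm {L : ℝ} (hL : 0 < L) {E E' X X' : ℕ → ℕ → ℝ × ℝ → ℝ}
    (hE : IsPerJet L 3 E) (hE' : IsPerJet L 3 E')
    (hX : X 0 0 =ᵐ[volume.restrict (square L)] fun p => E 0 0 p - (E 2 0 p + E 0 2 p))
    (hX' : X' 0 0 =ᵐ[volume.restrict (square L)] fun p => E' 0 0 p - (E' 2 0 p + E' 0 2 p)) :
    bil L (E 0 0) (X' 0 0) = bil L (E' 0 0) (X 0 0) := by
  have e := hE 0 0 (by norm_num)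
  have e' := hE' 0 0 (by norm_num)
  have s := bil_helmholtz hE hX e'.memLp
  have s' := bil_helmholtz hE' hX' e.memLp
  have h1 := (hE 1 0 (by norm_num)).bil_x hL e'
  have h2 := (hE 0 1 (by norm_num)).bil_y hL e'
  have h1' := (hE' 1 0 (by norm_num)).bil_x hL e
  have h2' := (hE' 0 1 (by norm_num)).bil_y hL e
  simp only [zero_add, Nat.reduceAdd] at h1 h2 h1' h2'
  rw [bil_comm L (E 0 0), bil_comm L (E' 0 0)]
  rw [bil_comm L (E' 0 0) (E 0 0), bil_comm L (E' 1 0) (E 1 0)] at *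
  rw [bil_comm L (E' 0 1) (E 0 1)] at *
  linarith

/-- The bound K is chosen strictly positive and affine in ‖J‖, so that it is integrable in time; the
H¹ norm of a second derivative involves three components of J. -/
theorem jet_norm_bound {L : ℝ} {J : Jet L 3} (hJ : J ∈ perSobolev L 3) {a b : ℕ}
    (hab : a + b = 2) : sobConst L * h1Sq L (jetFn J a b) (jetFn J (a + 1) b)
      (jetFn J a (b + 1)) ≤
        ENNReal.ofReal ((3 * (sobConst L).toReal + 1) * (1 + ‖J‖)) ^ 2 := by
  have hC : sobConst L ≠ ∞ := by simp [sobConst, ENNReal.mul_eq_top]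
  have hn : ∀ c d (h : c + d ≤ 3), bil L (jetFn J c d) (jetFn J c d) ≤ ‖J‖ ^ 2 := by
    intro c d h
    rw [jetFn_eq J h, ← inner_eq_bil, real_inner_self_eq_norm_sq]
    gcongr
    exact PiLp.norm_apply_le J (bi c d h)
  rw [(isPerJet_jetFn hJ a b (by omega)).h1Sq_eq, ← ENNReal.ofReal_toReal hC,
    ← ENNReal.ofReal_mul ENNReal.toReal_nonneg, ← ENNReal.ofReal_pow
      (mul_nonneg (by positivity) (by positivity))]
  rw [ENNReal.toReal_ofReal ENNReal.toReal_nonneg]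
  refine ENNReal.ofReal_le_ofReal ?_
  set S := (sobConst L).toReal
  have hS : 0 ≤ S := ENNReal.toReal_nonneg
  have h1 := hn a b (by omega)
  have h2 := hn (a + 1) b (by omega)
  have h3 := hn a (b + 1) (by omega)
  have hJ0 := norm_nonneg J
  calc _ ≤ S * (3 * ‖J‖ ^ 2) := by gcongr; linarith
    _ ≤ (3 * S + 1) ^ 2 * (1 + ‖J‖) ^ 2 := by
      have e1 : 3 * S ≤ (3 * S + 1) ^ 2 := by nlinarith
      have e2 : ‖J‖ ^ 2 ≤ (1 + ‖J‖) ^ 2 := by nlinarith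
      calc S * (3 * ‖J‖ ^ 2) = (3 * S) * ‖J‖ ^ 2 := by ring
        _ ≤ _ := by gcongr
    _ = _ := by ring

theorem coeFn_helmholtz {L : ℝ} (J : Jet L 3) :
    (helmholtz J : ℝ × ℝ → ℝ) =ᵐ[volume.restrict (square L)]
      fun p => jetFn J 0 0 p - (jetFn J 2 0 p + jetFn J 0 2 p) := by
  rw [jetFn_eq J (a := 0) (b := 0) (by omega), jetFn_eq J (a := 2) (b := 0) (by omega),
    jetFn_eq J (a := 0) (b := 2) (by omega), helmholtz]
  filter_upwards [Lp.coeFn_sub J.fn (Jet.D J 2 0 (by omega) + Jet.D J 0 2 (by omega)),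
    Lp.coeFn_add (Jet.D J 2 0 (by omega)) (Jet.D J 0 2 (by omega))] with p h1 h2
  rw [h1, Pi.sub_apply, h2]
  rfl

/-! ### The difference of two solutions at a fixed time -/

section difference

variable {L : ℝ} {U U₁ : Jet L 3} {W W₁ : Jet L 1} {u u₁ w w₁ : L2 L}

theorem jetFn_sub_ae {m : ℕ} {J J₁ : Jet L m} {f f₁ : L2 L} (h : J.fn = f) (h₁ : J₁.fn = f₁) :
    (fun p => jetFn J₁ 0 0 p - jetFn J 0 0 p) =ᵐ[volume.restrict (square L)]
      ((f₁ - f : L2 L) : ℝ × ℝ → ℝ) := by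
  rw [jetFn_eq J (a := 0) (b := 0) (by omega), jetFn_eq J₁ (a := 0) (b := 0) (by omega)]
  filter_upwards [Lp.coeFn_sub f₁ f] with p hp
  rw [hp, ← h, ← h₁]
  rfl

theorem helmholtz_sub_ae (hW : W.fn = w) (hW₁ : W₁.fn = w₁) (hw : helmholtz U = w)
    (hw₁ : helmholtz U₁ = w₁) :
    (fun p => jetFn W₁ 0 0 p - jetFn W 0 0 p) =ᵐ[volume.restrict (square L)]
      fun p => (jetFn U₁ 0 0 p - jetFn U 0 0 p) - ((jetFn U₁ 2 0 p - jetFn U 2 0 p) +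
        (jetFn U₁ 0 2 p - jetFn U 0 2 p)) := by
  rw [jetFn_eq W (a := 0) (b := 0) (by omega), jetFn_eq W₁ (a := 0) (b := 0) (by omega)]
  filter_upwards [coeFn_helmholtz U, coeFn_helmholtz U₁] with p h h₁
  have e : (Jet.D W 0 0 (by omega) : L2 L) = helmholtz U := hW.trans hw.symm
  have e₁ : (Jet.D W₁ 0 0 (by omega) : L2 L) = helmholtz U₁ := hW₁.trans hw₁.symm
  rw [e, e₁, h, h₁]; ring

/-- `u`, `w` and `w'` satisfy the Hasegawa-Mima system at a fixed time, where `U` and `W` are the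
families of derivatives of `u` and `w`. -/
structure SolvesAt (κ : ℝ) (U : Jet L 3) (W : Jet L 1) (u w w' : L2 L) : Prop where
  mem_U : U ∈ perSobolev L 3
  mem_W : W ∈ perSobolev L 1
  fn_U : U.fn = u
  fn_W : W.fn = w
  helmholtz_eq : helmholtz U = w
  eqn : ∀ᵐ p ∂(volume.restrict (square L)),
      w' p + (-(Jet.D U 0 1 (by omega) p) * Jet.D W 1 0 (by omega) p
          + Jet.D U 1 0 (by omega) p * Jet.D W 0 1 (by omega) p)
        = κ * Jet.D U 0 1 (by omega) p

namespace SolvesAt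

variable {κ : ℝ} {w' w₁' : L2 L}

theorem inner_sub_eq (S : SolvesAt κ U W u w w') (S₁ : SolvesAt κ U₁ W₁ u₁ w₁ w₁') :
    inner ℝ (u₁ - u) (w₁ - w) = bil L (fun p => jetFn U₁ 0 0 p - jetFn U 0 0 p)
      (fun p => jetFn W₁ 0 0 p - jetFn W 0 0 p) := by
  rw [inner_eq_bil]
  exact bil_congr (jetFn_sub_ae S.fn_U S₁.fn_U).symm (jetFn_sub_ae S.fn_W S₁.fn_W).symm

theorem isPerJet_U (S : SolvesAt κ U W u w w') (S₁ : SolvesAt κ U₁ W₁ u₁ w₁ w₁') :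
    IsPerJet L 3 (fun a b p => jetFn U₁ a b p - jetFn U a b p) :=
  (isPerJet_jetFn S₁.mem_U).sub (isPerJet_jetFn S.mem_U)

theorem isPerJet_W (S : SolvesAt κ U W u w w') (S₁ : SolvesAt κ U₁ W₁ u₁ w₁ w₁') :
    IsPerJet L 1 (fun a b p => jetFn W₁ a b p - jetFn W a b p) :=
  (isPerJet_jetFn S₁.mem_W).sub (isPerJet_jetFn S.mem_W)

theorem helmholtz_ae (S : SolvesAt κ U W u w w') (S₁ : SolvesAt κ U₁ W₁ u₁ w₁ w₁') :
    (fun a b p => jetFn W₁ a b p - jetFn W a b p) 0 0 =ᵐ[volume.restrict (square L)]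
      fun p => (fun a b p => jetFn U₁ a b p - jetFn U a b p) 0 0 p -
        ((fun a b p => jetFn U₁ a b p - jetFn U a b p) 2 0 p +
        (fun a b p => jetFn U₁ a b p - jetFn U a b p) 0 2 p) :=
  helmholtz_sub_ae S.fn_W S₁.fn_W S.helmholtz_eq S₁.helmholtz_eq

theorem inner_sub_nonneg (hL : 0 < L) (S : SolvesAt κ U W u w w')
    (S₁ : SolvesAt κ U₁ W₁ u₁ w₁ w₁') : 0 ≤ inner ℝ (u₁ - u) (w₁ - w) := by
  have h := bil_helmholtz_self
    (X := fun a b p => jetFn W₁ a b p - jetFn W a b p) hL (S.isPerJet_U S₁) (S.helmholtz_ae S₁)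
  rw [S.inner_sub_eq S₁, h]
  exact add_nonneg (add_nonneg (bil_self_nonneg _ _) (bil_self_nonneg _ _)) (bil_self_nonneg _ _)

/-- Zero energy kills η and ∇η almost everywhere, and then ‖ξ‖² = ⟨η, ξ⟩ + ⟨∇η, ∇ξ⟩ kills ξ. -/
theorem eq_of_inner_sub_eq_zero (hL : 0 < L) (S : SolvesAt κ U W u w w')
    (S₁ : SolvesAt κ U₁ W₁ u₁ w₁ w₁') (h0 : inner ℝ (u₁ - u) (w₁ - w) = 0) :
    u₁ = u ∧ w₁ = w := by
  have hE := S.isPerJet_U S₁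
  have hX := S.isPerJet_W S₁
  have hXE := S.helmholtz_ae S₁
  rw [S.inner_sub_eq S₁] at h0
  have h := bil_helmholtz_self
    (X := fun a b p => jetFn W₁ a b p - jetFn W a b p) hL hE hXE
  have hz := bil_self_eq hL hE hX hXE
  set E := fun a b p => jetFn U₁ a b p - jetFn U a b p
  set X := fun a b p => jetFn W₁ a b p - jetFn W a b p
  change bil L (E 0 0) (X 0 0) = 0 at h0
  rw [h0] at h hz
  have n0 := bil_self_nonneg L (E 0 0)
  have n1 := bil_self_nonneg L (E 1 0)
  have n2 := bil_self_nonneg L (E 0 1)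
  have e0 := ae_eq_zero_of_bil_self (hE 0 0 (by norm_num)).memLp (by linarith)
  have e1 := ae_eq_zero_of_bil_self (hE 0 0 (by norm_num)).memLp_x (by
    change bil L (E 1 0) (E 1 0) = 0; linarith)
  have e2 := ae_eq_zero_of_bil_self (hE 0 0 (by norm_num)).memLp_y (by
    change bil L (E 0 1) (E 0 1) = 0; linarith)
  rw [bil_zero_left e1, bil_zero_left e2] at hz
  have ex := ae_eq_zero_of_bil_self (hX 0 0 (by norm_num)).memLp (by linarith)
  constructor
  · rw [← sub_eq_zero, Lp.eq_zero_iff_ae_eq_zero]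
    exact (jetFn_sub_ae S.fn_U S₁.fn_U).symm.trans e0
  · rw [← sub_eq_zero, Lp.eq_zero_iff_ae_eq_zero]
    exact (jetFn_sub_ae S.fn_W S₁.fn_W).symm.trans ex

/-- Meant for two different times: it supplies the symmetry hypothesis of the energy identity. -/
theorem inner_sub_symm (hL : 0 < L) {V V₁ : Jet L 3} {Y Y₁ : Jet L 1} {v v₁ y y₁ y' y₁' : L2 L}
    (S : SolvesAt κ U W u w w') (S₁ : SolvesAt κ U₁ W₁ u₁ w₁ w₁')
    (R : SolvesAt κ V Y v y y') (R₁ : SolvesAt κ V₁ Y₁ v₁ y₁ y₁') :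
    inner ℝ (u₁ - u) (y₁ - y) = inner ℝ (v₁ - v) (w₁ - w) := by
  rw [inner_eq_bil, inner_eq_bil,
    bil_congr (jetFn_sub_ae S.fn_U S₁.fn_U).symm (jetFn_sub_ae R.fn_W R₁.fn_W).symm,
    bil_congr (jetFn_sub_ae R.fn_U R₁.fn_U).symm (jetFn_sub_ae S.fn_W S₁.fn_W).symm]
  exact bil_helmholtz_symm (X := fun a b p => jetFn W₁ a b p - jetFn W a b p)
    (X' := fun a b p => jetFn Y₁ a b p - jetFn Y a b p) hL (S.isPerJet_U S₁) (R.isPerJet_U R₁) (S.helmholtz_ae S₁)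
    (R.helmholtz_ae R₁)

theorem abs_inner_sub_le (hL : 0 < L) (S : SolvesAt κ U W u w w')
    (S₁ : SolvesAt κ U₁ W₁ u₁ w₁ w₁') (m : ℕ) :
    |inner ℝ (u₁ - u) (w₁' - w')| ≤
      12 * (m + 1) * ((3 * (sobConst L).toReal + 1) * (1 + ‖U‖)) *
        (inner ℝ (u₁ - u) (w₁ - w) +
        (4 ^ (m + 1))⁻¹ * ((logConst L).toReal * ‖w₁ - w‖ ^ 2)) := by
  -- The splitting {u₁, w₁} - {u, w} = {u, ξ} + {η, w₁} lets only the second derivatives of u enter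
  -- the estimate.
  have hN : ∀ᵐ p ∂(volume.restrict (square L)), ((w₁' - w' : L2 L) : ℝ × ℝ → ℝ) p =
      κ * (jetFn U₁ 0 1 p - jetFn U 0 1 p) -
      (jetFn U 1 0 p * (jetFn W₁ 0 1 p - jetFn W 0 1 p) -
        jetFn U 0 1 p * (jetFn W₁ 1 0 p - jetFn W 1 0 p)) -
      ((jetFn U₁ 1 0 p - jetFn U 1 0 p) * jetFn W₁ 0 1 p -
        (jetFn U₁ 0 1 p - jetFn U 0 1 p) * jetFn W₁ 1 0 p) := by
    filter_upwards [S.eqn, S₁.eqn, Lp.coeFn_sub w₁' w'] with p h h₁ hs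
    rw [jetFn_eq U (a := 0) (b := 1) (by omega), jetFn_eq U (a := 1) (b := 0) (by omega),
      jetFn_eq U₁ (a := 0) (b := 1) (by omega), jetFn_eq U₁ (a := 1) (b := 0) (by omega),
      jetFn_eq W (a := 0) (b := 1) (by omega), jetFn_eq W (a := 1) (b := 0) (by omega),
      jetFn_eq W₁ (a := 0) (b := 1) (by omega), jetFn_eq W₁ (a := 1) (b := 0) (by omega), hs,
      Pi.sub_apply]
    linear_combination h₁ - h
  have hK : 0 < (3 * (sobConst L).toReal + 1) * (1 + ‖U‖) := by
    have : 0 ≤ (sobConst L).toReal := ENNReal.toReal_nonneg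
    positivity
  have hrate := abs_energy_rate_le hL (S.isPerJet_U S₁) (isPerJet_jetFn S.mem_U) (S.isPerJet_W S₁)
    (isPerJet_jetFn S₁.mem_W) (S.helmholtz_ae S₁) hN hK
    (fun a b hab => jet_norm_bound S.mem_U hab) m
  have e1 : inner ℝ (u₁ - u) (w₁' - w') = bil L (fun p => jetFn U₁ 0 0 p - jetFn U 0 0 p)
      ((w₁' - w' : L2 L) : ℝ × ℝ → ℝ) := by
    rw [inner_eq_bil]
    exact bil_congr (jetFn_sub_ae S.fn_U S₁.fn_U).symm (EventuallyEq.refl _ _)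
  have e2 : ‖w₁ - w‖ ^ 2 = bil L (fun p => jetFn W₁ 0 0 p - jetFn W 0 0 p)
      (fun p => jetFn W₁ 0 0 p - jetFn W 0 0 p) := by
    rw [← real_inner_self_eq_norm_sq, inner_eq_bil]
    exact bil_congr (jetFn_sub_ae S.fn_W S₁.fn_W).symm (jetFn_sub_ae S.fn_W S₁.fn_W).symm
  rw [e1, e2, S.inner_sub_eq S₁]
  exact hrate

end SolvesAt

end difference

/-! ### Uniqueness -/

/-- Gathers the almost-everywhere conditions into one statement on the closed interval; square
integrability in time becomes integrability since T is finite. -/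
theorem IsSolution.exists_solvesAt {L T κ : ℝ} (hT : 0 < T) {u₀ : Jet L 3} {u w : ℝ → L2 L}
    (h : IsSolution T κ u₀ u w) :
    ∃ (U : ℝ → Jet L 3) (W : ℝ → Jet L 1) (w' : ℝ → L2 L),
      (∀ᵐ t ∂(volume.restrict (Set.Icc 0 T)), SolvesAt κ (U t) (W t) (u t) (w t) (w' t)) ∧
      ContinuousOn u (Set.Icc 0 T) ∧ ContinuousOn w (Set.Icc 0 T) ∧
      IntervalIntegrable U volume 0 T ∧ IntervalIntegrable w' volume 0 T ∧
      (∀ s t, 0 ≤ s → s ≤ t → t ≤ T → w t - w s = ∫ r in s..t, w' r) ∧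
      w 0 = helmholtz u₀ := by
  obtain ⟨U, U', W, w', hU, hW, heq, hhelm, -, hw0⟩ := h
  have hint : ∀ {F : Type} [NormedAddCommGroup F] {v : ℝ → F},
      MemLp v 2 (volume.restrict (Set.Ioo 0 T)) → IntegrableOn v (Set.Ioo 0 T) :=
    fun hv => hv.integrable (by norm_num)
  refine ⟨U, W, w', ?_, hU.continuousOn, hW.continuousOn, ?_, ?_, ?_, hw0⟩
  · rw [← Measure.restrict_congr_set Ioo_ae_eq_Icc]
    filter_upwards [heq, hhelm, hU.mem.2, hU.fn_eq, hW.mem.2, hW.fn_eq] with t h1 h2 h3 h4 h5 h6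
    exact ⟨h3, h5, h4, h6, h2, h1⟩
  · rw [intervalIntegrable_iff_integrableOn_Ioo_of_le hT.le]
    exact hint hU.mem.1
  · rw [intervalIntegrable_iff_integrableOn_Ioo_of_le hT.le]
    exact hint hW.mem_deriv
  · intro s t hs hst ht
    exact sub_eq_integral_of_weakDeriv hW.continuousOn (hint hW.mem_deriv) hW.deriv hs hst ht

theorem IsSolution.eqOn {L T κ : ℝ} (hL : 0 < L) (hT : 0 < T) {u₀ : Jet L 3}
    {u w u₁ w₁ : ℝ → L2 L} (h : IsSolution T κ u₀ u w) (h₁ : IsSolution T κ u₀ u₁ w₁) :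
    Set.EqOn u₁ u (Set.Icc 0 T) ∧ Set.EqOn w₁ w (Set.Icc 0 T) := by
  obtain ⟨U, W, w', hS, hu, hw, iU, iw', hftc, h0⟩ := h.exists_solvesAt hT
  obtain ⟨U₁, W₁, w₁', hS₁, hu₁, hw₁, -, iw₁', hftc₁, h0₁⟩ := h₁.exists_solvesAt hT
  have hη : ContinuousOn (fun t => u₁ t - u t) (Set.Icc 0 T) := hu₁.sub hu
  have hξ : ContinuousOn (fun t => w₁ t - w t) (Set.Icc 0 T) := hw₁.sub hw
  have hν : IntervalIntegrable (fun t => w₁' t - w' t) volume 0 T := iw₁'.sub iw'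
  have hdiff : ∀ s t, 0 ≤ s → s ≤ t → t ≤ T →
      (w₁ t - w t) - (w₁ s - w s) = ∫ r in s..t, (w₁' r - w' r) := by
    intro s t hs hst ht
    rw [intervalIntegral.integral_sub (intervalIntegrable_mono iw₁' hs hst ht)
      (intervalIntegrable_mono iw' hs hst ht), ← hftc s t hs hst ht, ← hftc₁ s t hs hst ht]
    abel
  have hsymm : ∀ s ∈ Set.Icc 0 T, ∀ t ∈ Set.Icc 0 T,
      inner ℝ (u₁ t - u t) (w₁ s - w s) = inner ℝ (u₁ s - u s) (w₁ t - w t) := by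
    -- Symmetry is known only at almost every pair of times. Continuity extends it to all t for a
    -- good s, then to all s.
    have hgood : ∀ᵐ s ∂(volume.restrict (Set.Icc 0 T)), ∀ t ∈ Set.Icc 0 T,
        inner ℝ (u₁ t - u t) (w₁ s - w s) = inner ℝ (u₁ s - u s) (w₁ t - w t) := by
      filter_upwards [hS, hS₁] with s a a₁
      refine Measure.eqOn_Icc_of_ae_eq volume hT.ne ?_ (hη.inner continuousOn_const)
        (continuousOn_const.inner hξ)
      filter_upwards [hS, hS₁] with t b b₁
      exact b.inner_sub_symm hL b₁ a a₁
    intro s hs t ht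
    refine Measure.eqOn_Icc_of_ae_eq volume hT.ne (f := fun s => inner ℝ (u₁ t - u t) (w₁ s - w s))
      (g := fun s => inner ℝ (u₁ s - u s) (w₁ t - w t)) ?_ (continuousOn_const.inner hξ)
      (hη.inner continuousOn_const) hs
    filter_upwards [hgood] with s h
    exact h t ht
  have henergy := inner_sub_eq_integral hT.le hη hν hdiff hsymm
  set E : ℝ → ℝ := fun t => inner ℝ (u₁ t - u t) (w₁ t - w t) with hE
  have hEc : ContinuousOn E (Set.Icc 0 T) := hη.inner hξ
  -- Nonnegativity almost everywhere is written as E = |E|, an equality of continuous functions,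
  -- which then holds everywhere.
  have hE0 : ∀ t ∈ Set.Icc 0 T, 0 ≤ E t := by
    have : Set.EqOn E (fun t => |E t|) (Set.Icc 0 T) := by
      refine Measure.eqOn_Icc_of_ae_eq volume hT.ne ?_ hEc hEc.abs
      filter_upwards [hS, hS₁] with t a a₁
      exact (abs_of_nonneg (a.inner_sub_nonneg hL a₁)).symm
    intro t ht
    rw [this ht]
    exact abs_nonneg _
  obtain ⟨B, hB⟩ := isCompact_Icc.exists_bound_of_continuousOn hξ
  set C := (logConst L).toReal
  have hC : 0 ≤ C := ENNReal.toReal_nonneg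
  set S := 3 * (sobConst L).toReal + 1
  have hSpos : 0 ≤ S := by
    have : 0 ≤ (sobConst L).toReal := ENNReal.toReal_nonneg
    positivity
  -- 24 is the constant 12 of the rate estimate times the 2 of the energy identity.
  have hk : IntervalIntegrable (fun t => 24 * (S * (1 + ‖U t‖))) volume 0 T :=
    ((intervalIntegrable_const.add iU.norm).const_mul S).const_mul 24
  have hzero : ∀ t ∈ Set.Icc 0 T, E t = 0 := by
    -- C B² bounds the error term uniformly in time; the + 1 only ensures M > 0.
    refine eq_zero_of_integral_le hT.le (M := C * B ^ 2 + 1) (by positivity) hEc hE0 hk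
      (fun t => by positivity) (by simp [hE, h0, h0₁]) ?_
    intro m s t hs hst ht
    rw [henergy s t hs hst ht]
    have i1 := (intervalIntegrable_inner hT.le hη hν).const_mul 2
    have i2 : IntervalIntegrable (fun r => ((m + 1) * (24 * (S * (1 + ‖U r‖)))) *
        (E r + (4 ^ (m + 1))⁻¹ * (C * B ^ 2 + 1))) volume 0 T :=
      (hk.const_mul _).mul_continuousOn (by
        rw [Set.uIcc_of_le hT.le]; exact hEc.add continuousOn_const)
    refine intervalIntegral.integral_mono_ae_restrict hst (intervalIntegrable_mono i1 hs hst ht)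
      (intervalIntegrable_mono i2 hs hst ht) ?_
    have hsub : Set.Icc s t ⊆ Set.Icc 0 T := Set.Icc_subset_Icc hs ht
    filter_upwards [ae_restrict_of_ae_restrict_of_subset hsub hS,
      ae_restrict_of_ae_restrict_of_subset hsub hS₁, ae_restrict_mem measurableSet_Icc]
      with r a a₁ hr
    have hb := hB r (hsub hr)
    have hrate := (le_abs_self _).trans (a.abs_inner_sub_le hL a₁ m)
    have hsq : ‖w₁ r - w r‖ ^ 2 ≤ B ^ 2 := by gcongr
    calc 2 * inner ℝ (u₁ r - u r) (w₁' r - w' r)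
        ≤ 2 * (12 * (m + 1) * (S * (1 + ‖U r‖)) * (E r + (4 ^ (m + 1))⁻¹ *
          (C * ‖w₁ r - w r‖ ^ 2))) := by linarith
      _ ≤ 2 * (12 * (m + 1) * (S * (1 + ‖U r‖)) * (E r + (4 ^ (m + 1))⁻¹ *
          (C * B ^ 2 + 1))) := by
        gcongr
        exact (mul_le_mul_of_nonneg_left hsq hC).trans (by linarith)
      _ = _ := by ring
  have hae : ∀ᵐ t ∂(volume.restrict (Set.Icc 0 T)), u₁ t = u t ∧ w₁ t = w t := by
    filter_upwards [hS, hS₁, ae_restrict_mem measurableSet_Icc] with t a a₁ ht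
    exact a.eq_of_inner_sub_eq_zero hL a₁ (hzero t ht)
  exact ⟨Measure.eqOn_Icc_of_ae_eq volume hT.ne (hae.mono fun t h => h.1) hu₁ hu,
    Measure.eqOn_Icc_of_ae_eq volume hT.ne (hae.mono fun t h => h.2) hw₁ hw⟩

end

end HasegawaMima

theorem mainTheorem7 (L T k : ℝ) (hL : 0 < L) (hT : 0 < T)
    (u₀ : HasegawaMima.Jet L 3) (hu₀ : u₀ ∈ HasegawaMima.perSobolev L 3)
    (hw₀ : MemLp (HasegawaMima.helmholtz u₀ : ℝ × ℝ → ℝ) ⊤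
      (volume.restrict (HasegawaMima.square L)))
    (u w : ℝ → HasegawaMima.L2 L) (hsol : HasegawaMima.IsSolution T k u₀ u w)
    (hw : HasegawaMima.ContinuousIntoLinfty T w) :
    ∀ u₁ w₁ : ℝ → HasegawaMima.L2 L, HasegawaMima.IsSolution T k u₀ u₁ w₁ →
      ∀ t ∈ Set.Icc 0 T, u₁ t = u t ∧ w₁ t = w t :=
  fun _ _ h₁ _ ht => ⟨(hsol.eqOn hL hT h₁).1 ht, (hsol.eqOn hL hT h₁).2 ht⟩
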